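/- Let $0<\beta<\alpha$ and let $g:\mathbb R\to\mathbb R$ be odd and of class $C^1$, with $g>0$ on $(0,\alpha)$, $g<0$ on $(\alpha,+\infty)$, $g'>0$ on $[0,\beta)$, $g'<0$ on $(\beta,+\infty)$, $g$ twice differentiable at $\pm\beta$ and $g''(\beta)<0$. Put $G(t)=\int_0^t g(s)\,ds$ and let $k\ge 2$ be an integer. For every $r_0>0$ the Cauchy problem $$\psi''+\frac{k-1}{r}\psi'+g(\psi)=0,\qquad \psi(r_0)=\beta,\qquad \psi'(r_0)=-\frac{g(\beta)}{k}r_0,$$ has a unique maximal solution $\psi$, defined on an open interval $J\subset(0,+\infty)$ containing $r_0$. Moreover there are positive real numbers $\underline{r_0},r_0^{**},\overline{r_0}$ with $$\frac{k\sqrt2}{g(\beta)}\Big(G(\alpha)-\frac1kG(\beta)\Big)^{1/2}\le\underline{r_0}\le r_0^{**}\le\overline{r_0}\le\frac{k\sqrt2}{g(\beta)}\Big(G(\alpha)-G(\beta)+\frac{k-1}{k}g(\beta)(\alpha+\beta)\Big)^{1/2}$$ such that the following holds. (i) If $0<r_0<\underline{r_0}$, then $(r_0,+\infty)\subset J$,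 $\psi(r)\in(-\alpha,\alpha)$ for all $r>r_0$, $\psi$ is nontrivial and has an unbounded set of zeros in $(r_0,+\infty)$, and $\psi(r)\to0$ as $r\to+\infty$. Moreover there is a sequence $r_0=s_0<s_1<s_2<\cdots$ with $s_n\to+\infty$ such that, for every integer $n\ge0$, $\psi$ is strictly monotone on $(s_n,s_{n+1})$ and $\psi(s_{2n})\psi(s_{2n+1})<0$. (ii) If $r_0=r_0^{**}$, then $(r_0,+\infty)\subset J$, $\psi'<0$ on $(r_0,+\infty)$, and $\psi(r)\to-\alpha$ as $r\to+\infty$. (iii) If $r_0>\overline{r_0}$, then $\psi'<0$ on $J\cap(r_0,+\infty)$, and $\psi(r)\to-\infty$ as $r\nearrow\sup J$ (where $\sup J\in(r_0,+\infty]$). -/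

import Mathlib

open Set Filter Topology

/-- A bistable nonlinearity `g` with parameters `0 < β < α`. -/
structure IsBistable (g : ℝ → ℝ) (α β : ℝ) : Prop where
  beta_pos : 0 < β
  beta_lt_alpha : β < α
  odd : ∀ u, g (-u) = -g u
  contDiff : ContDiff ℝ 1 g
  pos : ∀ u ∈ Ioo 0 α, 0 < g u
  neg : ∀ u ∈ Ioi α, g u < 0
  deriv_pos : ∀ u ∈ Ico 0 β, 0 < deriv g u
  deriv_neg : ∀ u ∈ Ioi β, deriv g u < 0
  twice_diff : DifferentiableAt ℝ (deriv g) β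
  twice_diff_neg : DifferentiableAt ℝ (deriv g) (-β)
  deriv2_neg : deriv (deriv g) β < 0

/-- The primitive `G(t) = ∫_0^t g(s) ds`. -/
noncomputable def primitiveG (g : ℝ → ℝ) (t : ℝ) : ℝ := ∫ s in (0 : ℝ)..t, g s

/-- `ψ` solves, on the open interval `J ⊆ (0, ∞)` containing `r₀`, the Cauchy problem
`ψ'' + (k - 1) ψ' / r + g(ψ) = 0`, `ψ(r₀) = ξ`, `ψ'(r₀) = θ`.
(Only the values of `ψ` on `J` matter; since `J` is open, the two-sided derivatives are those of
the restriction of `ψ` to `J`.) -/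
structure IsCauchySolution (k : ℕ) (g : ℝ → ℝ) (r₀ ξ θ : ℝ) (J : Set ℝ) (ψ : ℝ → ℝ) : Prop where
  isOpen : IsOpen J
  ordConnected : J.OrdConnected
  subset_pos : J ⊆ Ioi 0
  mem : r₀ ∈ J
  diff : ∀ r ∈ J, DifferentiableAt ℝ ψ r
  diff_deriv : ∀ r ∈ J, DifferentiableAt ℝ (deriv ψ) r
  ode : ∀ r ∈ J, deriv (deriv ψ) r + ((k : ℝ) - 1) / r * deriv ψ r + g (ψ r) = 0
  init : ψ r₀ = ξ
  init_deriv : deriv ψ r₀ = θ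

/-- `ψ`, defined on `J`, is a maximal solution: it has no extension, as a solution, to a
strictly larger open interval of `(0, ∞)`. -/
def IsMaximalSolution (k : ℕ) (g : ℝ → ℝ) (r₀ ξ θ : ℝ) (J : Set ℝ) (ψ : ℝ → ℝ) : Prop :=
  IsCauchySolution k g r₀ ξ θ J ψ ∧
    ∀ (J' : Set ℝ) (χ : ℝ → ℝ), IsCauchySolution k g r₀ ξ θ J' χ →
      J ⊆ J' → EqOn χ ψ J → J' = J

/-- `ψ`, considered on `(r₀, ∞)`, is nontrivial and has an unbounded set of zeros. -/
def IsOscillatingFrom (r₀ : ℝ) (ψ : ℝ → ℝ) : Prop :=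
  (∃ r, r₀ < r ∧ ψ r ≠ 0) ∧ ¬ BddAbove {r : ℝ | r₀ < r ∧ ψ r = 0}

/-- `ψ(+∞) = 0`. -/
def IsLocalized (ψ : ℝ → ℝ) : Prop := Tendsto ψ atTop (𝓝 0)

/-- `ψ(r) → -∞` as `r ↗ sup J` (where `sup J` may be `+∞`), for an open interval `J`:
`atTop` on the ordered subtype `J` is the filter of `r → sup J`, `r ∈ J`. -/
def TendstoNegInftyAtSup (J : Set ℝ) (ψ : ℝ → ℝ) : Prop :=
  Tendsto (fun r : J => ψ r) atTop atBot

/-! The energy `E = ψ'²/2 + G(ψ)` satisfies `E' = -(k - 1) ψ'²/r ≤ 0`, and `G(α)` is the height of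
the barrier that separates `(-α, α)` from the rest of the line. A solution inside `(-α, α)` with `E
< G(α)` is confined to a compact subinterval (`trapped`). It must then oscillate, since a solution
of one sign would make a Riccati variable blow up (`not_forall_pos`), and it tends to `0`, because a
positive limit of `E` would force a logarithmically divergent dissipation (`tendsto_zero`). A
solution that passes below `-α` meets `g > 0` and decreases from then on. It cannot converge,
because limits are zeros of `g` (`map_limit_eq_zero`), so it tends to `-∞`.

The thresholds come from the divergence form `(r^(k-1) ψ')' = -r^(k-1) g(ψ)`. The initial slope is
the value at `r₀` of `-g(β) r / k`, the slope attached to a constant forcing `g(β)`. Comparison of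
fluxes gives `ψ' ≤ -g(ψ) r / k` while `ψ` descends from `β` to `0`, hence `E - (k-1)/k G(ψ)`
decreases there; if `r₀` is below the lower threshold, `E < G(α)` when `ψ` reaches `0`
(`exists_abs_le_of_lt`). Conversely `g ≤ g(β)` on `[-α, β]` gives `ψ' ≥ -g(β) r / k`, hence `E -
(k-1)/k g(β) ψ` increases during the descent; above the upper threshold `E` stays above `G(α)` and
the solution crosses `-α` (`exists_lt_neg_alpha`).

The radius of the heteroclinic solution is found by shooting: it is the infimum of the radii whose
solution crosses `-α`. By continuous dependence crossing is an open condition, so the solution at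
the infimum does not cross; as a limit of decreasing solutions it is nonincreasing. Its limit is a
zero of `g` in `[-α, β]`, and `0` is excluded by oscillation. -/

/-- The pair `(ψ, φ)` solves the first order system `ψ' = φ`,
`φ' = -(k - 1) φ / r - g(ψ)` at every point of `S ⊆ (0, ∞)`. -/
def SolvesOn (k : ℕ) (g : ℝ → ℝ) (S : Set ℝ) (ψ φ : ℝ → ℝ) : Prop :=
  ∀ r ∈ S, 0 < r ∧ HasDerivAt ψ (φ r) r ∧
    HasDerivAt φ (-(((k : ℝ) - 1) / r * φ r) - g (ψ r)) r

/-! ### Truncation of the equation to a bounded Lipschitz field -/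

/-- Truncation of the real line to `[-M, M]`. -/
noncomputable def clampTo (M x : ℝ) : ℝ := max (-M) (min x M)

/-- A bounded, globally Lipschitz field which agrees with the field of the radial equation
on `{t ≥ c} × [-M, M]²`. -/
noncomputable def clampedField (k : ℕ) (g : ℝ → ℝ) (c M : ℝ) (t : ℝ) (p : ℝ × ℝ) : ℝ × ℝ :=
  (clampTo M p.2, -(((k : ℝ) - 1) / max t c * clampTo M p.2) - g (clampTo M p.1))

section Field

variable {k : ℕ} {g : ℝ → ℝ} {c M : ℝ}

lemma SolvesOn.mono {S T : Set ℝ} {ψ φ : ℝ → ℝ} (h : SolvesOn k g S ψ φ) (hT : T ⊆ S) :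
    SolvesOn k g T ψ φ := fun r hr => h r (hT hr)

lemma clampTo_of_abs_le {x : ℝ} (h : |x| ≤ M) : clampTo M x = x := by
  rw [abs_le] at h
  rw [clampTo, min_eq_left h.2, max_eq_right h.1]

lemma abs_clampTo_le (hM : 0 ≤ M) (x : ℝ) : |clampTo M x| ≤ M := by
  rw [abs_le, clampTo]
  exact ⟨le_max_left _ _, max_le (by linarith) (min_le_right _ _)⟩

lemma abs_clampTo_sub_le (x y : ℝ) : |clampTo M x - clampTo M y| ≤ |x - y| := by
  have h : LipschitzWith 1 (clampTo M) :=
    (LipschitzWith.id.min_const M).const_max (-M)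
  simpa [Real.dist_eq] using h.dist_le_mul x y

lemma exists_lipschitz_bound (hg : ContDiff ℝ 1 g) (hM : 0 ≤ M) :
    ∃ K : ℝ, 0 ≤ K ∧ (∀ x y, |g (clampTo M x) - g (clampTo M y)| ≤ K * |x - y|) ∧
      ∀ x, |g (clampTo M x)| ≤ K := by
  obtain ⟨K, hK⟩ := hg.contDiffOn.exists_lipschitzOnWith one_ne_zero
    (convex_Icc (-M) M) isCompact_Icc
  obtain ⟨C, hC⟩ := isCompact_Icc.exists_bound_of_continuousOn
    (hg.continuous.continuousOn (s := Icc (-M) M))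
  have hmem : ∀ x, clampTo M x ∈ Icc (-M) M := fun x => abs_le.1 (abs_clampTo_le hM x)
  refine ⟨max K C, le_max_of_le_left K.2, fun x y => ?_, fun x => ?_⟩
  · have := hK.dist_le_mul _ (hmem x) _ (hmem y)
    rw [Real.dist_eq, Real.dist_eq] at this
    calc _ ≤ _ := this
      _ ≤ max (K : ℝ) C * |x - y| :=
        mul_le_mul (le_max_left _ _) (abs_clampTo_sub_le x y) (abs_nonneg _)
          (le_max_of_le_left K.2)
  · exact (hC _ (hmem x)).trans (le_max_right _ _)

lemma abs_coeff_le (hc : 0 < c) (t : ℝ) : |((k : ℝ) - 1) / max t c| ≤ |(k : ℝ) - 1| / c := by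
  rw [abs_div, abs_of_pos (lt_max_of_lt_right hc)]
  gcongr
  exact le_max_right _ _

/-- The coefficient `(k - 1) / max t c` is bounded because `c > 0`, and `g` is Lipschitz on the
compact range of the truncation, so one constant serves for all times. -/
lemma exists_lipschitzWith_clampedField (hg : ContDiff ℝ 1 g) (hc : 0 < c) (hM : 0 ≤ M) :
    ∃ K : NNReal, ∀ t, LipschitzWith K (clampedField k g c M t) := by
  obtain ⟨K, hK0, hK, -⟩ := exists_lipschitz_bound hg hM
  have hA : 0 ≤ |(k : ℝ) - 1| / c := by positivity
  refine ⟨⟨1 + |(k : ℝ) - 1| / c + K, by positivity⟩, fun t => LipschitzWith.of_dist_le_mul ?_⟩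
  intro p q
  change _ ≤ (1 + |(k : ℝ) - 1| / c + K) * dist p q
  have h1 : |p.1 - q.1| ≤ dist p q := le_max_left _ _
  have h2 : |p.2 - q.2| ≤ dist p q := le_max_right _ _
  have hd : 0 ≤ dist p q := dist_nonneg
  have h3 := abs_clampTo_sub_le (M := M) p.2 q.2
  refine max_le ?_ ?_
  · simp only [clampedField, Real.dist_eq]
    nlinarith
  · simp only [clampedField, Real.dist_eq]
    calc _ = |-(((k : ℝ) - 1) / max t c * (clampTo M p.2 - clampTo M q.2))
          - (g (clampTo M p.1) - g (clampTo M q.1))| := by ring_nf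
      _ ≤ |((k : ℝ) - 1) / max t c| * |clampTo M p.2 - clampTo M q.2|
          + |g (clampTo M p.1) - g (clampTo M q.1)| := by
        refine (abs_sub _ _).trans ?_
        rw [abs_neg, abs_mul]
      _ ≤ |(k : ℝ) - 1| / c * dist p q + K * dist p q := by
        gcongr
        · exact abs_coeff_le hc t
        · exact h3.trans h2
        · exact (hK _ _).trans (by gcongr)
      _ ≤ _ := by nlinarith

lemma exists_norm_clampedField_le (hg : ContDiff ℝ 1 g) (hc : 0 < c) (hM : 0 ≤ M) :
    ∃ L : NNReal, ∀ t p, ‖clampedField k g c M t p‖ ≤ L := by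
  obtain ⟨K, hK0, -, hK⟩ := exists_lipschitz_bound hg hM
  have hA : 0 ≤ |(k : ℝ) - 1| / c := by positivity
  refine ⟨⟨M + |(k : ℝ) - 1| / c * M + K, by positivity⟩, fun t p => ?_⟩
  change _ ≤ M + |(k : ℝ) - 1| / c * M + K
  have h2 := abs_clampTo_le hM p.2
  have hAM : 0 ≤ |(k : ℝ) - 1| / c * M := by positivity
  refine max_le ?_ ?_
  · simp only [clampedField, Real.norm_eq_abs]
    linarith
  · simp only [clampedField, Real.norm_eq_abs]
    calc _ ≤ |((k : ℝ) - 1) / max t c| * |clampTo M p.2| + |g (clampTo M p.1)| := by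
          refine (abs_sub _ _).trans ?_
          rw [abs_neg, abs_mul]
      _ ≤ |(k : ℝ) - 1| / c * M + K := by
        gcongr
        · exact abs_coeff_le hc t
        · exact hK _
      _ ≤ _ := by linarith

lemma continuous_clampedField_time (hc : 0 < c) (p : ℝ × ℝ) :
    Continuous fun t => clampedField k g c M t p := by
  unfold clampedField
  have : ∀ t : ℝ, max t c ≠ 0 := fun t => (lt_max_of_lt_right hc).ne'
  fun_prop (disch := assumption)

/-- Global existence for the truncated field. -/
lemma exists_curve_clampedField (hg : ContDiff ℝ 1 g) (hc : 0 < c) (hM : 0 ≤ M)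
    {p t₀ q : ℝ} (ht : t₀ ∈ Ioo p q) (x : ℝ × ℝ) :
    ∃ γ : ℝ → ℝ × ℝ, γ t₀ = x ∧
      ∀ t ∈ Ioo p q, HasDerivAt γ (clampedField k g c M t (γ t)) t := by
  obtain ⟨K, hK⟩ := exists_lipschitzWith_clampedField (k := k) hg hc hM
  obtain ⟨L, hL⟩ := exists_norm_clampedField_le (k := k) hg hc hM
  have ht' : t₀ ∈ Icc p q := Ioo_subset_Icc_self ht
  have hpos : 0 ≤ max (q - t₀) (t₀ - p) := le_max_of_le_left (by linarith [ht.2])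
  -- The field is bounded by `L` everywhere, so a ball of radius `L` times the longest elapsed time
  -- cannot be left: no smallness of `[p, q]` is needed.
  have hPL : IsPicardLindelof (clampedField k g c M) (⟨t₀, ht'⟩ : Icc p q) x
      (L * ⟨max (q - t₀) (t₀ - p), hpos⟩) 0 L K :=
    { lipschitzOnWith := fun t _ => (hK t).lipschitzOnWith
      continuousOn := fun y _ => (continuous_clampedField_time hc y).continuousOn
      norm_le := fun t _ y _ => hL t y
      mul_max_le := by rw [NNReal.coe_zero, sub_zero]; exact le_rfl }
  obtain ⟨γ, h0, h⟩ := hPL.exists_eq_forall_mem_Icc_hasDerivWithinAt₀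
  exact ⟨γ, h0, fun t ht => (h t (Ioo_subset_Icc_self ht)).hasDerivAt (Icc_mem_nhds ht.1 ht.2)⟩

/-- A solution bounded by `M` is an integral curve of the truncated field. -/
lemma SolvesOn.hasDerivAt_clampedField {S : Set ℝ} {ψ φ : ℝ → ℝ} (h : SolvesOn k g S ψ φ)
    {r : ℝ} (hr : r ∈ S) (hcr : c ≤ r) (h1 : |ψ r| ≤ M) (h2 : |φ r| ≤ M) :
    HasDerivAt (fun t => (ψ t, φ t)) (clampedField k g c M r (ψ r, φ r)) r := by
  obtain ⟨-, hψ, hφ⟩ := h r hr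
  simp only [clampedField, clampTo_of_abs_le h1, clampTo_of_abs_le h2, max_eq_left hcr]
  exact hψ.prodMk hφ

lemma solvesOn_of_hasDerivAt_clampedField {S : Set ℝ} {γ : ℝ → ℝ × ℝ} (hc : 0 < c)
    (h : ∀ t ∈ S, c ≤ t ∧ ‖γ t‖ ≤ M ∧ HasDerivAt γ (clampedField k g c M t (γ t)) t) :
    SolvesOn k g S (fun t => (γ t).1) (fun t => (γ t).2) := by
  intro t ht
  obtain ⟨h1, h2, h3⟩ := h t ht
  have ha : |(γ t).1| ≤ M := (le_max_left _ _).trans h2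
  have hb : |(γ t).2| ≤ M := (le_max_right _ _).trans h2
  simp only [clampedField, clampTo_of_abs_le ha, clampTo_of_abs_le hb, max_eq_left h1] at h3
  exact ⟨hc.trans_le h1, h3.fst, h3.snd⟩

end Field

/-! ### The Cauchy problem: uniqueness, maximal solutions, continuous dependence -/

section Cauchy

variable {k : ℕ} {g : ℝ → ℝ} {r₀ ξ θ : ℝ} {J : Set ℝ} {ψ φ χ ω : ℝ → ℝ}

lemma SolvesOn.continuousOn_left (h : SolvesOn k g J ψ φ) : ContinuousOn ψ J :=
  fun r hr => (h r hr).2.1.continuousAt.continuousWithinAt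

lemma SolvesOn.continuousOn_right (h : SolvesOn k g J ψ φ) : ContinuousOn φ J :=
  fun r hr => (h r hr).2.2.continuousAt.continuousWithinAt

lemma SolvesOn.exists_bound (h : SolvesOn k g J ψ φ) {a b : ℝ} (hab : Icc a b ⊆ J) :
    ∃ M : ℝ, 0 ≤ M ∧ ∀ r ∈ Icc a b, |ψ r| ≤ M ∧ |φ r| ≤ M := by
  obtain ⟨M, hM⟩ := isCompact_Icc.exists_bound_of_continuousOn (h.continuousOn_left.mono hab)
  obtain ⟨N, hN⟩ := isCompact_Icc.exists_bound_of_continuousOn (h.continuousOn_right.mono hab)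
  exact ⟨max 0 (max M N), le_max_left _ _, fun r hr =>
    ⟨(hM r hr).trans ((le_max_left _ _).trans (le_max_right _ _)),
      (hN r hr).trans ((le_max_right _ _).trans (le_max_right _ _))⟩⟩

/-- Uniqueness of solutions with given Cauchy data. -/
lemma SolvesOn.eq_of_eq (hg : ContDiff ℝ 1 g) (hJ : J.OrdConnected)
    (h₁ : SolvesOn k g J ψ φ) (h₂ : SolvesOn k g J χ ω) (hr₀ : r₀ ∈ J)
    (e₁ : ψ r₀ = χ r₀) (e₂ : φ r₀ = ω r₀) {r : ℝ} (hr : r ∈ J) : ψ r = χ r ∧ φ r = ω r := by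
  rcases le_total r₀ r with hle | hle
  · have hsub : Icc r₀ r ⊆ J := hJ.out hr₀ hr
    obtain ⟨M, hM, b₁⟩ := h₁.exists_bound hsub
    obtain ⟨N, hN, b₂⟩ := h₂.exists_bound hsub
    have hMN : 0 ≤ max M N := le_max_of_le_left hM
    obtain ⟨K, hK⟩ := exists_lipschitzWith_clampedField (k := k) hg (h₁ r₀ hr₀).1 hMN
    have d₁ : ∀ t ∈ Icc r₀ r, HasDerivAt (fun t => (ψ t, φ t))
        (clampedField k g r₀ (max M N) t (ψ t, φ t)) t := fun t ht =>
      h₁.hasDerivAt_clampedField (hsub ht) ht.1 (le_max_of_le_left (b₁ t ht).1)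
        (le_max_of_le_left (b₁ t ht).2)
    have d₂ : ∀ t ∈ Icc r₀ r, HasDerivAt (fun t => (χ t, ω t))
        (clampedField k g r₀ (max M N) t (χ t, ω t)) t := fun t ht =>
      h₂.hasDerivAt_clampedField (hsub ht) ht.1 (le_max_of_le_right (b₂ t ht).1)
        (le_max_of_le_right (b₂ t ht).2)
    have := ODE_solution_unique_of_mem_Icc_right (s := fun _ => univ)
      (fun t _ => (hK t).lipschitzOnWith)
      (fun t ht => (d₁ t ht).continuousAt.continuousWithinAt)
      (fun t ht => (d₁ t (Ico_subset_Icc_self ht)).hasDerivWithinAt) (fun _ _ => trivial)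
      (fun t ht => (d₂ t ht).continuousAt.continuousWithinAt)
      (fun t ht => (d₂ t (Ico_subset_Icc_self ht)).hasDerivWithinAt) (fun _ _ => trivial)
      (Prod.ext e₁ e₂) (right_mem_Icc.2 hle)
    exact Prod.ext_iff.1 this
  · have hsub : Icc r r₀ ⊆ J := hJ.out hr hr₀
    obtain ⟨M, hM, b₁⟩ := h₁.exists_bound hsub
    obtain ⟨N, hN, b₂⟩ := h₂.exists_bound hsub
    have hMN : 0 ≤ max M N := le_max_of_le_left hM
    obtain ⟨K, hK⟩ := exists_lipschitzWith_clampedField (k := k) hg (h₁ r hr).1 hMN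
    have d₁ : ∀ t ∈ Icc r r₀, HasDerivAt (fun t => (ψ t, φ t))
        (clampedField k g r (max M N) t (ψ t, φ t)) t := fun t ht =>
      h₁.hasDerivAt_clampedField (hsub ht) ht.1 (le_max_of_le_left (b₁ t ht).1)
        (le_max_of_le_left (b₁ t ht).2)
    have d₂ : ∀ t ∈ Icc r r₀, HasDerivAt (fun t => (χ t, ω t))
        (clampedField k g r (max M N) t (χ t, ω t)) t := fun t ht =>
      h₂.hasDerivAt_clampedField (hsub ht) ht.1 (le_max_of_le_right (b₂ t ht).1)
        (le_max_of_le_right (b₂ t ht).2)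
    have := ODE_solution_unique_of_mem_Icc_left (s := fun _ => univ)
      (fun t _ => (hK t).lipschitzOnWith)
      (fun t ht => (d₁ t ht).continuousAt.continuousWithinAt)
      (fun t ht => (d₁ t (Ioc_subset_Icc_self ht)).hasDerivWithinAt) (fun _ _ => trivial)
      (fun t ht => (d₂ t ht).continuousAt.continuousWithinAt)
      (fun t ht => (d₂ t (Ioc_subset_Icc_self ht)).hasDerivWithinAt) (fun _ _ => trivial)
      (Prod.ext e₁ e₂) (left_mem_Icc.2 hle)
    exact Prod.ext_iff.1 this

lemma IsCauchySolution.solvesOn (h : IsCauchySolution k g r₀ ξ θ J ψ) :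
    SolvesOn k g J ψ (deriv ψ) := fun r hr =>
  ⟨h.subset_pos hr, (h.diff r hr).hasDerivAt, by
    have := (h.diff_deriv r hr).hasDerivAt
    rwa [show deriv (deriv ψ) r = -(((k : ℝ) - 1) / r * deriv ψ r) - g (ψ r) by
      linarith [h.ode r hr]] at this⟩

lemma isCauchySolution_of_solvesOn (ho : IsOpen J) (hJ : J.OrdConnected)
    (h : SolvesOn k g J ψ φ) (hr₀ : r₀ ∈ J) (e₁ : ψ r₀ = ξ) (e₂ : φ r₀ = θ) :
    IsCauchySolution k g r₀ ξ θ J ψ := by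
  have hd : ∀ r ∈ J, deriv ψ r = φ r := fun r hr => (h r hr).2.1.deriv
  have hev : ∀ r ∈ J, deriv ψ =ᶠ[𝓝 r] φ := fun r hr => by
    filter_upwards [ho.mem_nhds hr] with t ht using hd t ht
  refine ⟨ho, hJ, fun r hr => (h r hr).1, hr₀, fun r hr => (h r hr).2.1.differentiableAt,
    fun r hr => ((h r hr).2.2.congr_of_eventuallyEq (hev r hr)).differentiableAt,
    fun r hr => ?_, e₁, (hd r₀ hr₀).trans e₂⟩
  rw [(hev r hr).deriv_eq, (h r hr).2.2.deriv, hd r hr]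
  ring

lemma IsCauchySolution.eq_of_mem (hg : ContDiff ℝ 1 g) {J' : Set ℝ}
    (h : IsCauchySolution k g r₀ ξ θ J ψ) (h' : IsCauchySolution k g r₀ ξ θ J' χ)
    {r : ℝ} (hr : r ∈ J) (hr' : r ∈ J') : ψ r = χ r :=
  (SolvesOn.eq_of_eq hg (h.ordConnected.inter h'.ordConnected)
    (h.solvesOn.mono inter_subset_left) (h'.solvesOn.mono inter_subset_right)
    ⟨h.mem, h'.mem⟩ (h.init.trans h'.init.symm) (h.init_deriv.trans h'.init_deriv.symm)
    ⟨hr, hr'⟩).1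

/-- A function which coincides locally with solutions of a Cauchy problem is a solution. -/
lemma isCauchySolution_of_local (hr₀ : r₀ ∈ J)
    (h : ∀ r ∈ J, ∃ (J' : Set ℝ) (χ : ℝ → ℝ), IsCauchySolution k g r₀ ξ θ J' χ ∧ r ∈ J' ∧
      J' ⊆ J ∧ EqOn ψ χ J') : IsCauchySolution k g r₀ ξ θ J ψ := by
  have hev : ∀ r ∈ J, ∃ (J' : Set ℝ) (χ : ℝ → ℝ), IsCauchySolution k g r₀ ξ θ J' χ ∧ r ∈ J' ∧
      ψ =ᶠ[𝓝 r] χ := fun r hr => by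
    obtain ⟨J', χ, h1, h2, -, h4⟩ := h r hr
    exact ⟨J', χ, h1, h2, by
      filter_upwards [h1.isOpen.mem_nhds h2] with t ht using h4 ht⟩
  refine ⟨?_, ?_, ?_, hr₀, ?_, ?_, ?_, ?_, ?_⟩
  · refine isOpen_iff_forall_mem_open.2 fun r hr => ?_
    obtain ⟨J', χ, h1, h2, h3, -⟩ := h r hr
    exact ⟨J', h3, h1.isOpen, h2⟩
  · refine ordConnected_of_uIcc_subset_left (x := r₀) fun r hr => ?_
    obtain ⟨J', χ, h1, h2, h3, -⟩ := h r hr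
    exact (h1.ordConnected.uIcc_subset h1.mem h2).trans h3
  · intro r hr
    obtain ⟨J', χ, h1, h2, -⟩ := h r hr
    exact h1.subset_pos h2
  · intro r hr
    obtain ⟨J', χ, h1, h2, h3⟩ := hev r hr
    exact (h1.diff r h2).congr_of_eventuallyEq h3
  · intro r hr
    obtain ⟨J', χ, h1, h2, h3⟩ := hev r hr
    exact (h1.diff_deriv r h2).congr_of_eventuallyEq h3.deriv
  · intro r hr
    obtain ⟨J', χ, h1, h2, h3⟩ := hev r hr
    rw [h3.deriv.deriv_eq, h3.deriv_eq, h3.eq_of_nhds]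
    exact h1.ode r h2
  · obtain ⟨J', χ, h1, h2, h3⟩ := hev r₀ hr₀
    rw [h3.eq_of_nhds, h1.init]
  · obtain ⟨J', χ, h1, h2, h3⟩ := hev r₀ hr₀
    rw [h3.deriv_eq, h1.init_deriv]

/-- A maximal solution extends every solution of the same Cauchy problem. -/
lemma IsMaximalSolution.subset (hg : ContDiff ℝ 1 g) {J' : Set ℝ}
    (h : IsMaximalSolution k g r₀ ξ θ J ψ) (h' : IsCauchySolution k g r₀ ξ θ J' χ) :
    J' ⊆ J ∧ EqOn χ ψ J' := by
  classical
  have hsub : J' ⊆ J := by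
    have heq : EqOn (J.piecewise ψ χ) ψ J := J.piecewise_eqOn ψ χ
    have heq' : EqOn (J.piecewise ψ χ) χ J' := fun r hr => by
      by_cases hrJ : r ∈ J
      · rw [piecewise_eq_of_mem _ _ _ hrJ]
        exact h.1.eq_of_mem hg h' hrJ hr
      · rw [piecewise_eq_of_notMem _ _ _ hrJ]
    have hU : IsCauchySolution k g r₀ ξ θ (J ∪ J') (J.piecewise ψ χ) := by
      refine isCauchySolution_of_local (Or.inl h.1.mem) ?_
      rintro r (hr | hr)
      · exact ⟨J, ψ, h.1, hr, subset_union_left, heq⟩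
      · exact ⟨J', χ, h', hr, subset_union_right, heq'⟩
    rw [← h.2 _ _ hU subset_union_left heq]
    exact subset_union_right
  exact ⟨hsub, fun r hr => h'.eq_of_mem hg h.1 hr (hsub hr)⟩

/-- The strict bound `‖γ‖ < M` at the two end points persists slightly beyond them, so the
truncation is invisible on an open interval. This is how integral curves of the truncated field
yield extensions of solutions. -/
lemma exists_Ioo_solvesOn {c M p q x y : ℝ} {γ : ℝ → ℝ × ℝ} (hc : 0 < c) (hcp : c ≤ p)
    (hxy : x ≤ y) (hpx : p < x) (hyq : y < q)
    (h : ∀ t ∈ Ioo p q, HasDerivAt γ (clampedField k g c M t (γ t)) t)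
    (hM : ∀ t ∈ Icc x y, ‖γ t‖ < M) :
    ∃ p' q', p' < x ∧ y < q' ∧
      SolvesOn k g (Ioo p' q') (fun t => (γ t).1) (fun t => (γ t).2) := by
  have key : ∀ z ∈ Icc x y, ∃ ε > 0, ∀ t, |t - z| < ε → ‖γ t‖ < M := fun z hz => by
    have hcont : ContinuousAt (fun t => ‖γ t‖) z :=
      (h z ⟨hpx.trans_le hz.1, hz.2.trans_lt hyq⟩).continuousAt.norm
    exact Metric.eventually_nhds_iff.1 (hcont.eventually_lt continuousAt_const (hM z hz))
  obtain ⟨ε, hε, h1⟩ := key x (left_mem_Icc.2 hxy)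
  obtain ⟨δ, hδ, h2⟩ := key y (right_mem_Icc.2 hxy)
  refine ⟨max p (x - ε), min q (y + δ), max_lt hpx (by linarith), lt_min hyq (by linarith),
    solvesOn_of_hasDerivAt_clampedField hc (M := M) fun t ht => ?_⟩
  obtain ⟨⟨a1, a2⟩, a3, a4⟩ : (p < t ∧ x - ε < t) ∧ t < q ∧ t < y + δ := by
    simpa only [mem_Ioo, max_lt_iff, lt_min_iff] using ht
  refine ⟨hcp.trans a1.le, ?_, h t ⟨a1, a3⟩⟩
  rcases lt_or_ge t x with htx | htx
  · exact (h1 t (by rw [abs_lt]; constructor <;> linarith)).le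
  rcases lt_or_ge y t with hty | hty
  · exact (h2 t (by rw [abs_lt]; constructor <;> linarith)).le
  · exact (hM t ⟨htx, hty⟩).le

/-- Local existence. -/
lemma exists_isCauchySolution (hg : ContDiff ℝ 1 g) (hr₀ : 0 < r₀) (ξ θ : ℝ) :
    ∃ (J : Set ℝ) (ψ : ℝ → ℝ), IsCauchySolution k g r₀ ξ θ J ψ := by
  have hc : 0 < r₀ / 2 := by positivity
  have hM : 0 ≤ ‖(ξ, θ)‖ + 1 := by positivity
  obtain ⟨γ, h0, hγ⟩ := exists_curve_clampedField (k := k) hg hc hM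
    (p := r₀ / 2) (t₀ := r₀) (q := r₀ + 1) ⟨by linarith, by linarith⟩ (ξ, θ)
  obtain ⟨p, q, hp, hq, h⟩ := exists_Ioo_solvesOn hc le_rfl (le_refl r₀) (by linarith)
    (by linarith) hγ (fun t ht => by
      rw [le_antisymm ht.2 ht.1, h0]
      linarith)
  exact ⟨Ioo p q, _, isCauchySolution_of_solvesOn isOpen_Ioo ordConnected_Ioo h ⟨hp, hq⟩
    (by simp [h0]) (by simp [h0])⟩

/-- Existence and uniqueness of the maximal solution. -/
lemma exists_isMaximalSolution (hg : ContDiff ℝ 1 g) (hr₀ : 0 < r₀) (ξ θ : ℝ) :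
    ∃ (J : Set ℝ) (ψ : ℝ → ℝ), IsMaximalSolution k g r₀ ξ θ J ψ ∧
      ∀ (J' : Set ℝ) (χ : ℝ → ℝ), IsMaximalSolution k g r₀ ξ θ J' χ → J' = J ∧ EqOn χ ψ J := by
  classical
  let P : ℝ → Prop := fun r => ∃ q : Set ℝ × (ℝ → ℝ), IsCauchySolution k g r₀ ξ θ q.1 q.2 ∧ r ∈ q.1
  -- Any two solutions agree on their common domain, so the choice is immaterial; the value `0` off
  -- the union of all domains plays no role.
  let f : ℝ → ℝ := fun r => if h : P r then h.choose.2 r else 0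
  have hf : ∀ (J' : Set ℝ) (χ : ℝ → ℝ), IsCauchySolution k g r₀ ξ θ J' χ → EqOn f χ J' := by
    intro J' χ hχ r hr
    have hP : P r := ⟨(J', χ), hχ, hr⟩
    simp only [f, dif_pos hP]
    exact hP.choose_spec.1.eq_of_mem hg hχ hP.choose_spec.2 hr
  have hsub : ∀ (J' : Set ℝ) (χ : ℝ → ℝ), IsCauchySolution k g r₀ ξ θ J' χ → J' ⊆ {r | P r} :=
    fun J' χ hχ r hr => ⟨(J', χ), hχ, hr⟩
  have hsol : IsCauchySolution k g r₀ ξ θ {r | P r} f := by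
    obtain ⟨J', χ, hχ⟩ := exists_isCauchySolution (k := k) hg hr₀ ξ θ
    refine isCauchySolution_of_local (hsub J' χ hχ hχ.mem) fun r hr => ?_
    obtain ⟨q, hq, hrq⟩ := hr
    exact ⟨q.1, q.2, hq, hrq, hsub _ _ hq, hf _ _ hq⟩
  have hmax : IsMaximalSolution k g r₀ ξ θ {r | P r} f :=
    ⟨hsol, fun J' χ hχ h1 _ => (hsub J' χ hχ).antisymm h1⟩
  refine ⟨_, f, hmax, fun J' χ hχ => ?_⟩
  have hJ : J' = {r | P r} := (hmax.subset hg hχ.1).1.antisymm (hχ.subset hg hsol).1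
  exact ⟨hJ, hJ ▸ (hmax.subset hg hχ.1).2⟩

lemma IsCauchySolution.pos (h : IsCauchySolution k g r₀ ξ θ J ψ) : 0 < r₀ := h.subset_pos h.mem

/-- A bounded maximal solution exists for all large times. -/
lemma IsMaximalSolution.Ioi_subset (hg : ContDiff ℝ 1 g) (h : IsMaximalSolution k g r₀ ξ θ J ψ)
    {M : ℝ} (hb : ∀ r ∈ J, r₀ ≤ r → |ψ r| ≤ M ∧ |deriv ψ r| ≤ M) : Ioi r₀ ⊆ J := by
  intro b hb₀
  by_contra hbJ
  have hr₀ := h.1.pos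
  have hM : 0 ≤ M := (abs_nonneg _).trans (hb r₀ h.1.mem le_rfl).1
  have hbdd : ∀ r ∈ J, r < b := fun r hr => by
    by_contra! hbr
    exact hbJ (h.1.ordConnected.out h.1.mem hr ⟨le_of_lt hb₀, hbr⟩)
  set s := sSup J
  have hBA : BddAbove J := ⟨b, fun r hr => (hbdd r hr).le⟩
  have hsJ : s ∉ J := fun hs => by
    obtain ⟨ε, hε, hball⟩ := Metric.isOpen_iff.1 h.1.isOpen s hs
    have hmem : s + ε / 2 ∈ J := hball (by
      rw [Metric.mem_ball, Real.dist_eq, abs_of_pos] <;> linarith)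
    linarith [le_csSup hBA hmem]
  have hr₀s : r₀ < s := lt_of_le_of_ne (le_csSup hBA h.1.mem) fun e => hsJ (e ▸ h.1.mem)
  have hsub : Ico r₀ s ⊆ J := fun r hr => by
    obtain ⟨t, ht, hrt⟩ := exists_lt_of_lt_csSup ⟨r₀, h.1.mem⟩ hr.2
    exact h.1.ordConnected.out h.1.mem ht ⟨hr.1, hrt.le⟩
  have hc : 0 < r₀ / 2 := by positivity
  -- The margin `1` turns the bound `M` on the solution into a strict one for the truncated curve,
  -- which exists up to time `s + 1` and so continues the solution past the supposed end `s`.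
  have hM1 : 0 ≤ M + 1 := by positivity
  obtain ⟨γ, h0, hγ⟩ := exists_curve_clampedField (k := k) hg hc hM1
    (p := r₀ / 2) (t₀ := r₀) (q := s + 1) ⟨by linarith, by linarith⟩ (ψ r₀, deriv ψ r₀)
  obtain ⟨K, hK⟩ := exists_lipschitzWith_clampedField (k := k) hg hc hM1
  have heq : ∀ t ∈ Ico r₀ s, γ t = (ψ t, deriv ψ t) := fun t ht => by
    have hsub' : Icc r₀ t ⊆ J := fun u hu => hsub ⟨hu.1, hu.2.trans_lt ht.2⟩
    have d₁ : ∀ u ∈ Icc r₀ t, HasDerivAt γ (clampedField k g (r₀ / 2) (M + 1) u (γ u)) u :=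
      fun u hu => hγ u ⟨by linarith [hu.1], by linarith [hu.2, ht.2]⟩
    have d₂ : ∀ u ∈ Icc r₀ t, HasDerivAt (fun t => (ψ t, deriv ψ t))
        (clampedField k g (r₀ / 2) (M + 1) u (ψ u, deriv ψ u)) u := fun u hu =>
      h.1.solvesOn.hasDerivAt_clampedField (hsub' hu) (by linarith [hu.1])
        (by linarith [(hb u (hsub' hu) hu.1).1]) (by linarith [(hb u (hsub' hu) hu.1).2])
    exact ODE_solution_unique_of_mem_Icc_right (s := fun _ => univ)
      (fun t _ => (hK t).lipschitzOnWith)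
      (fun t ht => (d₁ t ht).continuousAt.continuousWithinAt)
      (fun t ht => (d₁ t (Ico_subset_Icc_self ht)).hasDerivWithinAt) (fun _ _ => trivial)
      (fun t ht => (d₂ t ht).continuousAt.continuousWithinAt)
      (fun t ht => (d₂ t (Ico_subset_Icc_self ht)).hasDerivWithinAt) (fun _ _ => trivial)
      h0 (right_mem_Icc.2 ht.1)
  have hle : ∀ t ∈ Ico r₀ s, ‖γ t‖ ≤ M := fun t ht => by
    rw [heq t ht]
    exact max_le (hb t (hsub ht) ht.1).1 (hb t (hsub ht) ht.1).2
  have hles : ‖γ s‖ ≤ M := by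
    have hcont : ContinuousAt (fun t => ‖γ t‖) s :=
      (hγ s ⟨by linarith, by linarith⟩).continuousAt.norm
    refine le_of_tendsto (hcont.tendsto.mono_left (nhdsWithin_le_nhds (s := Iio s))) ?_
    filter_upwards [Ioo_mem_nhdsLT hr₀s] with t ht using hle t (Ioo_subset_Ico_self ht)
  obtain ⟨p, q, hp, hq, hsol⟩ := exists_Ioo_solvesOn hc le_rfl hr₀s.le (by linarith)
    (by linarith) hγ (fun t ht => by
      rcases ht.2.lt_or_eq with hlt | rfl
      · linarith [hle t ⟨ht.1, hlt⟩]
      · linarith)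
  refine hsJ ((h.subset hg (isCauchySolution_of_solvesOn isOpen_Ioo ordConnected_Ioo hsol
    ⟨hp, hr₀s.trans hq⟩ ?_ ?_)).1 ⟨hp.trans hr₀s, hq⟩)
  · simp [h0, h.1.init]
  · simp [h0, h.1.init_deriv]

/-- Continuous dependence on the initial time. -/
lemma IsCauchySolution.eventually_close (hg : ContDiff ℝ 1 g) {Θ : ℝ → ℝ}
    (h : IsCauchySolution k g r₀ ξ (Θ r₀) J ψ) (hΘ : ContinuousAt Θ r₀)
    {r : ℝ} (hr : r ∈ J) (hr₀r : r₀ < r) {ε : ℝ} (hε : 0 < ε) :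
    ∀ᶠ s in 𝓝 r₀, ∀ (J' : Set ℝ) (χ : ℝ → ℝ), IsMaximalSolution k g s ξ (Θ s) J' χ →
      r ∈ J' ∧ |χ r - ψ r| < ε ∧ |deriv χ r - deriv ψ r| < ε := by
  obtain ⟨δ, hδ, hball⟩ := Metric.isOpen_iff.1 h.isOpen r₀ h.mem
  -- The perturbed initial time may lie to the left of `r₀`, so the bounds are taken from an earlier
  -- time.
  set a := r₀ - δ / 2 with ha
  have haJ : a ∈ J := hball (by
    rw [Metric.mem_ball, Real.dist_eq, abs_lt]
    constructor <;> linarith)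
  have ha0 : 0 < a := h.subset_pos haJ
  have hsub : Icc a r ⊆ J := h.ordConnected.out haJ hr
  obtain ⟨M, hM, hbd⟩ := h.solvesOn.exists_bound hsub
  have hM1 : 0 ≤ M + 1 := by positivity
  have ha2 : 0 < a / 2 := by positivity
  obtain ⟨K, hK⟩ := exists_lipschitzWith_clampedField (k := k) hg ha2 hM1
  have hcont : ContinuousAt
      (fun s => dist (ξ, Θ s) (ψ s, deriv ψ s) * Real.exp (K * (r - a))) r₀ := by
    have c1 := (h.diff r₀ h.mem).continuousAt
    have c2 := (h.diff_deriv r₀ h.mem).continuousAt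
    fun_prop
  -- The Gronwall estimate starts at time `s` from the distance between the new data and the
  -- reference solution there. The cap `1` keeps the truncated curve strictly within `M + 1`, where
  -- it is a true solution.
  have hlt : dist (ξ, Θ r₀) (ψ r₀, deriv ψ r₀) * Real.exp (K * (r - a)) < min ε 1 := by
    rw [h.init, h.init_deriv, dist_self, zero_mul]
    exact lt_min hε one_pos
  filter_upwards [hcont.eventually_lt continuousAt_const hlt,
    Ioo_mem_nhds (show a < r₀ by linarith) hr₀r] with s hs hsI J' χ hχ
  obtain ⟨γ, h0, hγ⟩ := exists_curve_clampedField (k := k) hg ha2 hM1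
    (p := a / 2) (t₀ := s) (q := r + 1) ⟨by linarith [hsI.1], by linarith [hsI.2]⟩ (ξ, Θ s)
  have hsub' : ∀ u ∈ Icc s r, u ∈ Icc a r := fun u hu => ⟨hsI.1.le.trans hu.1, hu.2⟩
  have d₁ : ∀ u ∈ Icc s r, HasDerivAt γ (clampedField k g (a / 2) (M + 1) u (γ u)) u :=
    fun u hu => hγ u ⟨by linarith [hu.1, hsI.1], by linarith [hu.2]⟩
  have d₂ : ∀ u ∈ Icc s r, HasDerivAt (fun t => (ψ t, deriv ψ t))
      (clampedField k g (a / 2) (M + 1) u (ψ u, deriv ψ u)) u := fun u hu =>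
    h.solvesOn.hasDerivAt_clampedField (hsub (hsub' u hu)) (by linarith [(hsub' u hu).1])
      (by linarith [(hbd u (hsub' u hu)).1]) (by linarith [(hbd u (hsub' u hu)).2])
  have hclose : ∀ t ∈ Icc s r, dist (γ t) (ψ t, deriv ψ t) < min ε 1 := fun t ht => by
    have := dist_le_of_trajectories_ODE hK
      (fun t ht => (d₁ t ht).continuousAt.continuousWithinAt)
      (fun t ht => (d₁ t (Ico_subset_Icc_self ht)).hasDerivWithinAt)
      (fun t ht => (d₂ t ht).continuousAt.continuousWithinAt)
      (fun t ht => (d₂ t (Ico_subset_Icc_self ht)).hasDerivWithinAt)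
      (by rw [h0]) t ht
    refine this.trans_lt (lt_of_le_of_lt ?_ hs)
    gcongr
    · exact ht.2
    · exact hsI.1.le
  obtain ⟨p, q, hp, hq, hsol⟩ := exists_Ioo_solvesOn ha2 le_rfl hsI.2.le (by linarith [hsI.1])
    (by linarith) hγ (fun t ht => by
      have h1 := (hclose t ht).trans_le (min_le_right _ _)
      have h2 : ‖(ψ t, deriv ψ t)‖ ≤ M := max_le (hbd t (hsub' t ht)).1 (hbd t (hsub' t ht)).2
      have h3 : ‖γ t‖ ≤ ‖(ψ t, deriv ψ t)‖ + dist (γ t) (ψ t, deriv ψ t) := by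
        rw [dist_eq_norm]
        exact norm_le_norm_add_norm_sub' _ _
      linarith)
  have hcs := isCauchySolution_of_solvesOn (ξ := ξ) (θ := Θ s) isOpen_Ioo ordConnected_Ioo hsol
    ⟨hp, hsI.2.trans hq⟩ (by simp [h0]) (by simp [h0])
  obtain ⟨hsub1, heq⟩ := hχ.subset hg hcs
  have hrm : r ∈ Ioo p q := ⟨hp.trans hsI.2, hq⟩
  have hfin := (hclose r ⟨hsI.2.le, le_rfl⟩).trans_le (min_le_left _ _)
  have hev : (fun t => (γ t).1) =ᶠ[𝓝 r] χ := by
    filter_upwards [isOpen_Ioo.mem_nhds hrm] with t ht using heq ht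
  have hd : deriv χ r = (γ r).2 := by rw [← hev.deriv_eq, (hsol r hrm).2.1.deriv]
  refine ⟨hsub1 hrm, ?_, ?_⟩
  · rw [← heq hrm, ← Real.dist_eq]
    exact (le_max_left _ _).trans_lt hfin
  · rw [hd, ← Real.dist_eq]
    exact (le_max_right _ _).trans_lt hfin

end Cauchy

/-! ### Monotonicity from derivatives on intervals, first zeros -/

section Calculus

variable {f f' : ℝ → ℝ} {S : Set ℝ}

lemma antitoneOn_of_hasDerivAt_nonpos (hS : S.OrdConnected)
    (hf : ∀ x ∈ S, HasDerivAt f (f' x) x) (h : ∀ x ∈ S, f' x ≤ 0) : AntitoneOn f S :=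
  antitoneOn_of_deriv_nonpos hS.convex
    (fun x hx => (hf x hx).continuousAt.continuousWithinAt)
    (fun x hx => (hf x (interior_subset hx)).differentiableAt.differentiableWithinAt)
    (fun x hx => by
      rw [(hf x (interior_subset hx)).deriv]
      exact h x (interior_subset hx))

lemma monotoneOn_of_hasDerivAt_nonneg (hS : S.OrdConnected)
    (hf : ∀ x ∈ S, HasDerivAt f (f' x) x) (h : ∀ x ∈ S, 0 ≤ f' x) : MonotoneOn f S :=
  monotoneOn_of_deriv_nonneg hS.convex
    (fun x hx => (hf x hx).continuousAt.continuousWithinAt)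
    (fun x hx => (hf x (interior_subset hx)).differentiableAt.differentiableWithinAt)
    (fun x hx => by
      rw [(hf x (interior_subset hx)).deriv]
      exact h x (interior_subset hx))

lemma strictAntiOn_of_hasDerivAt_neg (hS : S.OrdConnected)
    (hf : ∀ x ∈ S, HasDerivAt f (f' x) x) (h : ∀ x ∈ interior S, f' x < 0) : StrictAntiOn f S :=
  strictAntiOn_of_deriv_neg hS.convex
    (fun x hx => (hf x hx).continuousAt.continuousWithinAt)
    (fun x hx => by
      rw [(hf x (interior_subset hx)).deriv]
      exact h x hx)

lemma strictMonoOn_of_hasDerivAt_pos (hS : S.OrdConnected)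
    (hf : ∀ x ∈ S, HasDerivAt f (f' x) x) (h : ∀ x ∈ interior S, 0 < f' x) : StrictMonoOn f S :=
  strictMonoOn_of_deriv_pos hS.convex
    (fun x hx => (hf x hx).continuousAt.continuousWithinAt)
    (fun x hx => by
      rw [(hf x (interior_subset hx)).deriv]
      exact h x hx)

/-- The first zero of a continuous function which is negative at the left end point. -/
lemma exists_first_zero {a b : ℝ} (hab : a ≤ b) (hf : ContinuousOn f (Icc a b)) (ha : f a < 0)
    (hb : 0 ≤ f b) : ∃ t ∈ Ioc a b, f t = 0 ∧ ∀ r ∈ Ico a t, f r < 0 := by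
  set Z : Set ℝ := Icc a b ∩ f ⁻¹' Ici 0
  have hZ : IsClosed Z := hf.preimage_isClosed_of_isClosed isClosed_Icc isClosed_Ici
  have hne : Z.Nonempty := ⟨b, right_mem_Icc.2 hab, hb⟩
  have hbd : BddBelow Z := ⟨a, fun x hx => hx.1.1⟩
  have hmem : sInf Z ∈ Z := hZ.csInf_mem hne hbd
  have hlt : ∀ r ∈ Ico a (sInf Z), f r < 0 := fun r hr => by
    by_contra! h0
    have : r ∈ Z := ⟨⟨hr.1, hr.2.le.trans hmem.1.2⟩, h0⟩
    linarith [csInf_le hbd this, hr.2]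
  have hat : a < sInf Z := lt_of_le_of_ne hmem.1.1 fun e => by
    have h1 : 0 ≤ f (sInf Z) := hmem.2
    rw [← e] at h1
    linarith
  refine ⟨sInf Z, ⟨hat, hmem.1.2⟩, le_antisymm ?_ hmem.2, hlt⟩
  have hc : Tendsto f (𝓝[Ico a (sInf Z)] (sInf Z)) (𝓝 (f (sInf Z))) :=
    (hf _ hmem.1).mono fun r hr => ⟨hr.1, hr.2.le.trans hmem.1.2⟩
  have : (𝓝[Ico a (sInf Z)] (sInf Z)).NeBot := by
    rw [← mem_closure_iff_nhdsWithin_neBot, closure_Ico hat.ne]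
    exact right_mem_Icc.2 hat.le
  exact le_of_tendsto hc (eventually_mem_nhdsWithin.mono fun r hr => (hlt r hr).le)

end Calculus

/-! ### The nonlinearity and its primitive -/

namespace IsBistable

variable {g : ℝ → ℝ} {α β : ℝ}

lemma continuous (hg : IsBistable g α β) : Continuous g := hg.contDiff.continuous

lemma alpha_pos (hg : IsBistable g α β) : 0 < α := hg.beta_pos.trans hg.beta_lt_alpha

lemma map_zero (hg : IsBistable g α β) : g 0 = 0 := by
  have := hg.odd 0
  rw [neg_zero] at this
  linarith

lemma map_alpha (hg : IsBistable g α β) : g α = 0 := by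
  have hc : ContinuousAt g α := hg.continuous.continuousAt
  apply le_antisymm
  · refine le_of_tendsto (hc.tendsto.mono_left (nhdsWithin_le_nhds (s := Ioi α))) ?_
    filter_upwards [self_mem_nhdsWithin] with u hu using (hg.neg u hu).le
  · refine ge_of_tendsto (hc.tendsto.mono_left (nhdsWithin_le_nhds (s := Iio α))) ?_
    filter_upwards [Ioo_mem_nhdsLT hg.alpha_pos] with u hu using (hg.pos u hu).le

lemma map_neg_alpha (hg : IsBistable g α β) : g (-α) = 0 := by
  rw [hg.odd, hg.map_alpha, neg_zero]

lemma map_beta_pos (hg : IsBistable g α β) : 0 < g β := hg.pos β ⟨hg.beta_pos, hg.beta_lt_alpha⟩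

lemma hasDerivAt (hg : IsBistable g α β) (u : ℝ) : HasDerivAt g (deriv g u) u :=
  (hg.contDiff.differentiable one_ne_zero u).hasDerivAt

lemma monotoneOn (hg : IsBistable g α β) : MonotoneOn g (Icc 0 β) :=
  (strictMonoOn_of_hasDerivAt_pos ordConnected_Icc (fun u _ => hg.hasDerivAt u) fun u hu => by
    rw [interior_Icc] at hu
    exact hg.deriv_pos u ⟨hu.1.le, hu.2⟩).monotoneOn

lemma neg_of_mem (hg : IsBistable g α β) {u : ℝ} (hu : u ∈ Ioo (-α) 0) : g u < 0 := by
  have := hg.pos (-u) ⟨by linarith [hu.2], by linarith [hu.1]⟩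
  rw [hg.odd] at this
  linarith

lemma pos_of_lt_neg_alpha (hg : IsBistable g α β) {u : ℝ} (hu : u < -α) : 0 < g u := by
  have := hg.neg (-u) (show α < -u by linarith)
  rw [hg.odd] at this
  linarith

/-- This is the bound behind the upper threshold: below `β` and down to `-α`, the forcing never
exceeds its value at the starting point. -/
lemma le_map_beta (hg : IsBistable g α β) {u : ℝ} (hu : u ∈ Icc (-α) β) : g u ≤ g β := by
  rcases lt_or_ge u 0 with h0 | h0
  · rcases hu.1.eq_or_lt with rfl | h1
    · rw [hg.map_neg_alpha]
      exact hg.map_beta_pos.le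
    · exact (hg.neg_of_mem ⟨h1, h0⟩).le.trans hg.map_beta_pos.le
  · exact hg.monotoneOn ⟨h0, hu.2⟩ ⟨hg.beta_pos.le, le_rfl⟩ hu.2

lemma eq_of_map_eq_zero (hg : IsBistable g α β) {u : ℝ} (h1 : -α ≤ u) (h2 : u < α)
    (h : g u = 0) : u = -α ∨ u = 0 := by
  rcases h1.eq_or_lt with rfl | h1
  · exact Or.inl rfl
  rcases lt_trichotomy u 0 with h0 | h0 | h0
  · exact absurd h (hg.neg_of_mem ⟨h1, h0⟩).ne
  · exact Or.inr h0
  · exact absurd h (hg.pos u ⟨h0, h2⟩).ne'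

/-- Two-sided linear bounds for `g` on a compact subinterval of `(-α, α)`. -/
lemma exists_linear_bounds (hg : IsBistable g α β) {a : ℝ} (ha0 : 0 < a) (ha : a < α) :
    ∃ c C : ℝ, 0 < c ∧ 0 < C ∧ ∀ u ∈ Icc 0 a, c * u ≤ g u ∧ g u ≤ C * u := by
  -- The quotient `g(u)/u`, extended by `g'(0) > 0` at `0`, is continuous and positive on `[0, a]`;
  -- its extrema are the two constants.
  have hcont : ContinuousOn (dslope g 0) (Icc 0 a) := by
    have : ContinuousOn (dslope g 0) univ := (continuousOn_dslope univ_mem).2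
      ⟨hg.continuous.continuousOn, (hg.hasDerivAt 0).differentiableAt⟩
    exact this.mono (subset_univ _)
  have hne : (Icc 0 a).Nonempty := ⟨0, left_mem_Icc.2 ha0.le⟩
  have hval : ∀ u, dslope g 0 u * u = g u := fun u => by
    have := sub_smul_dslope g 0 u
    rw [hg.map_zero, smul_eq_mul] at this
    linarith
  have hpos : ∀ u ∈ Icc 0 a, 0 < dslope g 0 u := fun u hu => by
    rcases hu.1.eq_or_lt with rfl | h0
    · rw [dslope_same]
      exact hg.deriv_pos 0 ⟨le_rfl, hg.beta_pos⟩
    · have h1 := hg.pos u ⟨h0, hu.2.trans_lt ha⟩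
      rw [← hval u] at h1
      exact pos_of_mul_pos_left h1 h0.le
  obtain ⟨x, hx, hmin⟩ := isCompact_Icc.exists_isMinOn hne hcont
  obtain ⟨y, hy, hmax⟩ := isCompact_Icc.exists_isMaxOn hne hcont
  refine ⟨_, _, hpos x hx, hpos y hy, fun u hu => ⟨?_, ?_⟩⟩
  · rw [← hval u]
    exact mul_le_mul_of_nonneg_right (hmin hu) hu.1
  · rw [← hval u]
    exact mul_le_mul_of_nonneg_right (hmax hu) hu.1

lemma hasDerivAt_primitiveG (hg : IsBistable g α β) (t : ℝ) :
    HasDerivAt (primitiveG g) (g t) t :=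
  intervalIntegral.integral_hasDerivAt_right (hg.continuous.intervalIntegrable _ _)
    hg.continuous.aestronglyMeasurable.stronglyMeasurableAtFilter hg.continuous.continuousAt

lemma continuous_primitiveG (hg : IsBistable g α β) : Continuous (primitiveG g) :=
  continuous_iff_continuousAt.2 fun t => (hg.hasDerivAt_primitiveG t).continuousAt

lemma primitiveG_zero : primitiveG g 0 = 0 := by simp [primitiveG]

lemma primitiveG_neg (hg : IsBistable g α β) (t : ℝ) : primitiveG g (-t) = primitiveG g t := by
  have h := intervalIntegral.integral_comp_neg (a := 0) (b := t) g
  simp only [hg.odd, intervalIntegral.integral_neg, neg_zero] at h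
  rw [primitiveG, primitiveG, intervalIntegral.integral_symm, ← h, neg_neg]

lemma primitiveG_abs (hg : IsBistable g α β) (t : ℝ) : primitiveG g |t| = primitiveG g t := by
  rcases abs_choice t with h | h <;> rw [h]
  exact hg.primitiveG_neg t

lemma strictMonoOn_primitiveG (hg : IsBistable g α β) : StrictMonoOn (primitiveG g) (Icc 0 α) :=
  strictMonoOn_of_hasDerivAt_pos ordConnected_Icc (fun u _ => hg.hasDerivAt_primitiveG u)
    fun u hu => by
      rw [interior_Icc] at hu
      exact hg.pos u hu

lemma primitiveG_lt (hg : IsBistable g α β) {u : ℝ} (hu : |u| < α) :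
    primitiveG g u < primitiveG g α := by
  rw [← hg.primitiveG_abs]
  exact hg.strictMonoOn_primitiveG ⟨abs_nonneg u, hu.le⟩ ⟨hg.alpha_pos.le, le_rfl⟩ hu

lemma primitiveG_le (hg : IsBistable g α β) {u : ℝ} (hu : |u| ≤ α) :
    primitiveG g u ≤ primitiveG g α := by
  rw [← hg.primitiveG_abs]
  exact hg.strictMonoOn_primitiveG.monotoneOn ⟨abs_nonneg u, hu⟩ ⟨hg.alpha_pos.le, le_rfl⟩ hu

lemma primitiveG_nonneg (hg : IsBistable g α β) {u : ℝ} (hu : |u| ≤ α) : 0 ≤ primitiveG g u := by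
  rw [← hg.primitiveG_abs, ← primitiveG_zero (g := g)]
  exact hg.strictMonoOn_primitiveG.monotoneOn ⟨le_rfl, hg.alpha_pos.le⟩ ⟨abs_nonneg u, hu⟩
    (abs_nonneg u)

/-- Two-sided quadratic bounds on a compact subinterval of `(-α, α)`. -/
lemma exists_quadratic_bounds (hg : IsBistable g α β) {a : ℝ} (ha0 : 0 < a) (ha : a < α) :
    ∃ c C : ℝ, 0 < c ∧ 0 < C ∧ ∀ u, |u| ≤ a → c * u ^ 2 ≤ u * g u ∧
      c / 2 * u ^ 2 ≤ primitiveG g u ∧ primitiveG g u ≤ C / 2 * u ^ 2 := by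
  obtain ⟨c, C, hc, hC, h⟩ := hg.exists_linear_bounds ha0 ha
  refine ⟨c, C, hc, hC, fun u hu => ?_⟩
  have hd : ∀ (b x : ℝ), HasDerivAt (fun x => primitiveG g x - b / 2 * x ^ 2) (g x - b * x) x :=
    fun b x => by
      have := (hg.hasDerivAt_primitiveG x).sub ((hasDerivAt_pow 2 x).const_mul (b / 2))
      convert! this using 1
      push_cast
      ring
  have h0 : (0 : ℝ) ∈ Icc 0 a := left_mem_Icc.2 ha0.le
  have hu' : |u| ∈ Icc 0 a := ⟨abs_nonneg u, hu⟩
  refine ⟨?_, ?_, ?_⟩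
  · rcases le_total 0 u with hu0 | hu0
    · rw [abs_of_nonneg hu0] at hu'
      nlinarith [(h u hu').1]
    · rw [abs_of_nonpos hu0] at hu'
      have := (h _ hu').1
      rw [hg.odd] at this
      nlinarith
  · have := monotoneOn_of_hasDerivAt_nonneg ordConnected_Icc (fun x _ => hd c x)
      (fun x hx => sub_nonneg.2 (h x hx).1) h0 hu' hu'.1
    simp only [primitiveG_zero, hg.primitiveG_abs, sq_abs] at this
    linarith
  · have := antitoneOn_of_hasDerivAt_nonpos ordConnected_Icc (fun x _ => hd C x)
      (fun x hx => sub_nonpos.2 (h x hx).2) h0 hu' hu'.1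
    simp only [primitiveG_zero, hg.primitiveG_abs, sq_abs] at this
    linarith

end IsBistable

/-! ### Energy, flux and asymptotics of solutions -/

/-- The energy `ψ'² / 2 + G(ψ)`. -/
noncomputable def energy (g ψ φ : ℝ → ℝ) (r : ℝ) : ℝ := φ r ^ 2 / 2 + primitiveG g (ψ r)

namespace SolvesOn

variable {k : ℕ} {g : ℝ → ℝ} {α β : ℝ} {J : Set ℝ} {ψ φ : ℝ → ℝ}

lemma hasDerivAt_energy (hg : IsBistable g α β) (h : SolvesOn k g J ψ φ) {r : ℝ} (hr : r ∈ J) :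
    HasDerivAt (energy g ψ φ) (-(((k : ℝ) - 1) / r * φ r ^ 2)) r := by
  obtain ⟨-, h1, h2⟩ := h r hr
  have := ((h2.pow 2).div_const 2).add ((hg.hasDerivAt_primitiveG (ψ r)).comp r h1)
  convert! this using 1
  push_cast
  ring

/-- The equation in divergence form. The sign of `g(ψ)` alone governs the monotonicity of the flux,
which has the sign of `ψ'`. -/
lemma hasDerivAt_flux (hk : 2 ≤ k) (h : SolvesOn k g J ψ φ) {r : ℝ} (hr : r ∈ J) :
    HasDerivAt (fun r => r ^ (k - 1) * φ r) (-(r ^ (k - 1) * g (ψ r))) r := by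
  obtain ⟨n, rfl⟩ := Nat.exists_eq_add_of_le' hk
  obtain ⟨h0, h1, h2⟩ := h r hr
  have := (hasDerivAt_pow (n + 1) r).mul h2
  refine this.congr_deriv ?_
  simp only [Nat.add_sub_cancel]
  rw [show n + 2 - 1 = n + 1 from rfl]
  push_cast
  field_simp
  ring

lemma neg (hg : IsBistable g α β) (h : SolvesOn k g J ψ φ) :
    SolvesOn k g J (fun r => -ψ r) (fun r => -φ r) := fun r hr => by
  obtain ⟨h0, h1, h2⟩ := h r hr
  refine ⟨h0, h1.neg, h2.neg.congr_deriv ?_⟩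
  rw [hg.odd]
  ring

lemma energy_antitoneOn (hk : 2 ≤ k) (hg : IsBistable g α β) (hJ : J.OrdConnected)
    (h : SolvesOn k g J ψ φ) : AntitoneOn (energy g ψ φ) J :=
  antitoneOn_of_hasDerivAt_nonpos hJ (fun r hr => h.hasDerivAt_energy hg hr) fun r hr => by
    have h0 := (h r hr).1
    have hk1 : (0 : ℝ) ≤ (k : ℝ) - 1 := by
      have : (2 : ℝ) ≤ k := by exact_mod_cast hk
      linarith
    have : 0 ≤ ((k : ℝ) - 1) / r * φ r ^ 2 := by positivity
    linarith

/-- A solution through an equilibrium is constant. -/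
lemma eq_of_equilibrium (hg : IsBistable g α β) (hJ : J.OrdConnected) (h : SolvesOn k g J ψ φ)
    {t : ℝ} (ht : t ∈ J) (h1 : φ t = 0) (h2 : g (ψ t) = 0) {r : ℝ} (hr : r ∈ J) : ψ r = ψ t := by
  have hconst : SolvesOn k g J (fun _ => ψ t) (fun _ => 0) := fun s hs =>
    ⟨(h s hs).1, hasDerivAt_const _ _, (hasDerivAt_const _ _).congr_deriv (by rw [h2]; ring)⟩
  exact (h.eq_of_eq hg.contDiff hJ hconst ht rfl h1 hr).1

/-- If `g(l) > 0`, integrating the divergence form gives a flux of at most `C - c r^k / k`, hence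
`ψ' ≤ -1` eventually, which is incompatible with convergence. -/
lemma not_map_limit_pos (hk : 2 ≤ k) (hg : IsBistable g α β) {R l : ℝ}
    (h : SolvesOn k g (Ioi R) ψ φ) (hl : Tendsto ψ atTop (𝓝 l)) : ¬ 0 < g l := by
  intro hgl
  set c := g l / 2
  have hc : 0 < c := half_pos hgl
  have hev : ∀ᶠ r in atTop, c < g (ψ r) :=
    (hg.continuous.continuousAt.tendsto.comp hl).eventually_const_lt (half_lt_self hgl)
  obtain ⟨R₁, hR₁⟩ := eventually_atTop.1
    (hev.and ((eventually_gt_atTop R).and (eventually_ge_atTop 1)))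
  have hkpos : (0 : ℝ) < k := by
    have : 0 < k := by lia
    exact_mod_cast this
  have hanti : AntitoneOn (fun r => r ^ (k - 1) * φ r + c * (r ^ k / k)) (Ici R₁) := by
    refine antitoneOn_of_hasDerivAt_nonpos ordConnected_Ici (fun r hr =>
      (h.hasDerivAt_flux hk (hR₁ r hr).2.1).add
        (((hasDerivAt_pow k r).div_const (k : ℝ)).const_mul c)) fun r hr => ?_
    have hr1 := (hR₁ r hr).1
    have hr0 : 0 < r ^ (k - 1) := pow_pos (by linarith [(hR₁ r hr).2.2]) _
    have : c * (↑k * r ^ (k - 1) / ↑k) = c * r ^ (k - 1) := by field_simp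
    rw [this]
    nlinarith
  set C := R₁ ^ (k - 1) * φ R₁ + c * (R₁ ^ k / k)
  -- Beyond this radius `c r / k ≥ |C| + 1`, which after division of the flux estimate by `r^(k-1) ≥
  -- 1` leaves `φ r ≤ -1`.
  have hφ : ∀ r, max R₁ ((|C| + 1) * k / c) ≤ r → φ r ≤ -1 := fun r hr => by
    have hrR : R₁ ≤ r := (le_max_left _ _).trans hr
    have hr1 : 1 ≤ r := (hR₁ r hrR).2.2
    have h1 : r ^ (k - 1) * φ r + c * (r ^ k / k) ≤ C := hanti self_mem_Ici hrR hrR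
    have h2 : (|C| + 1) * k / c ≤ r := (le_max_right _ _).trans hr
    rw [div_le_iff₀ hc] at h2
    have hp : 1 ≤ r ^ (k - 1) := one_le_pow₀ hr1
    have hpk : r ^ k = r ^ (k - 1) * r := by
      rw [← pow_succ]
      congr 1
      lia
    have h3 : |C| + 1 ≤ c * (r / k) := by
      rw [← mul_div_assoc, le_div_iff₀ hkpos]
      linarith
    have h4 : C ≤ r ^ (k - 1) * |C| := by nlinarith [le_abs_self C, abs_nonneg C]
    have h5 : r ^ (k - 1) * φ r + r ^ (k - 1) * (c * (r / k)) ≤ r ^ (k - 1) * |C| := by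
      calc _ = r ^ (k - 1) * φ r + c * (r ^ k / k) := by rw [hpk]; ring
        _ ≤ _ := h1.trans h4
    have h6 : φ r + c * (r / k) ≤ |C| := by
      refine le_of_mul_le_mul_left ?_ (show 0 < r ^ (k - 1) by linarith)
      linarith
    linarith
  set R₂ := max R₁ ((|C| + 1) * k / c)
  have hanti2 : AntitoneOn (fun r => ψ r + r) (Ici R₂) :=
    antitoneOn_of_hasDerivAt_nonpos ordConnected_Ici (fun r hr =>
      (h r (hR₁ r ((le_max_left _ _).trans hr)).2.1).2.1.add (hasDerivAt_id r))
      fun r hr => by linarith [hφ r hr]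
  have hlim : Tendsto (fun r => ψ r + r) atTop atTop := hl.add_atTop tendsto_id
  obtain ⟨r, hr1, hr2⟩ :=
    ((hlim.eventually_gt_atTop (ψ R₂ + R₂)).and (eventually_ge_atTop R₂)).exists
  have : ψ r + r ≤ ψ R₂ + R₂ := hanti2 self_mem_Ici hr2 hr2
  linarith

/-- The limit at infinity of a solution is a zero of `g`. -/
lemma map_limit_eq_zero (hk : 2 ≤ k) (hg : IsBistable g α β) {R l : ℝ}
    (h : SolvesOn k g (Ioi R) ψ φ) (hl : Tendsto ψ atTop (𝓝 l)) : g l = 0 := by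
  have h1 := h.not_map_limit_pos hk hg hl
  have h2 := (h.neg hg).not_map_limit_pos hk hg hl.neg
  rw [hg.odd] at h2
  linarith

/-- No solution stays forever in `(0, a]`, `a < α`: the function `arctan (-ψ' / ψ)` would
grow linearly. -/
lemma not_forall_pos (hg : IsBistable g α β) {R a : ℝ} (ha : a < α)
    (h : SolvesOn k g (Ioi R) ψ φ) (hpos : ∀ r, R < r → 0 < ψ r) (hle : ∀ r, R < r → ψ r ≤ a) :
    False := by
  have ha0 : 0 < a := (hpos (R + 1) (by linarith)).trans_le (hle (R + 1) (by linarith))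
  obtain ⟨c, C, hc, -, hb⟩ := hg.exists_linear_bounds ha0 ha
  set n : ℝ := (k : ℝ) - 1
  -- Together, `r ≥ 1` and `r ≥ n²/c` make the friction negligible: `(n/r)² ≤ c`.
  set R₁ := max (R + 1) (max 1 (n ^ 2 / c))
  set m := min c 1 / 2
  have hm : 0 < m := by positivity
  have hRR : ∀ r ∈ Ici R₁, R < r := fun r hr => by
    linarith [(le_max_left (R + 1) (max 1 (n ^ 2 / c))).trans (mem_Ici.1 hr)]
  have hderiv : ∀ r ∈ Ici R₁, HasDerivAt (fun r => Real.arctan (-φ r / ψ r) - m * r)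
      (1 / (1 + (-φ r / ψ r) ^ 2) *
        ((-(-(n / r * φ r) - g (ψ r)) * ψ r - -φ r * φ r) / ψ r ^ 2) - m * 1) r := fun r hr => by
    obtain ⟨-, h1, h2⟩ := h r (hRR r hr)
    exact ((h2.neg.div h1 (hpos r (hRR r hr)).ne').arctan).sub ((hasDerivAt_id r).const_mul m)
  have hmono : MonotoneOn (fun r => Real.arctan (-φ r / ψ r) - m * r) (Ici R₁) := by
    refine monotoneOn_of_hasDerivAt_nonneg ordConnected_Ici hderiv fun r hr => ?_
    have hψ := hpos r (hRR r hr)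
    have hg1 := (hb (ψ r) ⟨hψ.le, hle r (hRR r hr)⟩).1
    have hr1 : 1 ≤ r := (le_max_left _ _).trans ((le_max_right _ _).trans hr)
    have hrn : n ^ 2 / c ≤ r := (le_max_right _ _).trans ((le_max_right _ _).trans hr)
    -- Riccati variable: `p' = g(ψ)/ψ - (n/r) p + p²`. Since `g(ψ)/ψ ≥ c` and `(n/r) p ≤ (n/r)²/2 +
    -- p²/2`, one gets `p' ≥ (c + p²)/2 ≥ m (1 + p²)`.
    set p := -φ r / ψ r with hp
    have e : (-(-(n / r * φ r) - g (ψ r)) * ψ r - -φ r * φ r) / ψ r ^ 2 =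
        g (ψ r) / ψ r - n / r * p + p ^ 2 := by
      rw [hp]
      field_simp
      ring
    rw [e]
    have hq : c ≤ g (ψ r) / ψ r := by rwa [le_div_iff₀ hψ]
    have hn : (n / r) ^ 2 ≤ c := by
      rw [div_pow, div_le_iff₀ (by positivity)]
      rw [div_le_iff₀ hc] at hrn
      nlinarith
    have hm1 : m ≤ c / 2 := by
      have : min c 1 ≤ c := min_le_left _ _
      simp only [m]; linarith
    have hm2 : m ≤ 1 / 2 := by
      have : min c 1 ≤ 1 := min_le_right _ _
      simp only [m]; linarith
    have hkey : m * (1 + p ^ 2) ≤ g (ψ r) / ψ r - n / r * p + p ^ 2 := by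
      nlinarith [sq_nonneg (n / r - p), sq_nonneg p]
    have h1p : 0 < 1 + p ^ 2 := by positivity
    rw [one_div_mul_eq_div, mul_one, sub_nonneg, le_div_iff₀ h1p]
    exact hkey
  have hlim : Tendsto (fun r : ℝ => m * r) atTop atTop := tendsto_id.const_mul_atTop hm
  -- The arctangent would have to grow by more than `4`, while its range has length `π < 4`.
  obtain ⟨r, hr1, hr2⟩ := ((hlim.eventually_gt_atTop (m * R₁ + 4)).and
    (eventually_ge_atTop R₁)).exists
  have h1 : Real.arctan (-φ R₁ / ψ R₁) - m * R₁ ≤ Real.arctan (-φ r / ψ r) - m * r :=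
    hmono self_mem_Ici hr2 hr2
  have h2 := Real.arctan_lt_pi_div_two (-φ r / ψ r)
  have h3 := Real.neg_pi_div_two_lt_arctan (-φ R₁ / ψ R₁)
  have h4 := Real.pi_lt_four
  linarith

/-- A solution which enters `(-α, α)` with energy below `G(α)` stays in a compact subset. -/
lemma trapped (hk : 2 ≤ k) (hg : IsBistable g α β) (hJ : J.OrdConnected)
    (h : SolvesOn k g J ψ φ) {t : ℝ} (ht : t ∈ J) (h1 : |ψ t| < α)
    (h2 : energy g ψ φ t < primitiveG g α) :
    ∃ a, 0 < a ∧ a < α ∧ ∀ r ∈ J, t ≤ r → |ψ r| ≤ a := by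
  -- By continuity of `G` at `α`, the barrier is already higher than the energy at some `a < α`, and
  -- reaching `|ψ| = a` would require energy at least `G(a)`.
  obtain ⟨a, ha1, ha2, ha3⟩ : ∃ a, |ψ t| < a ∧ a < α ∧ energy g ψ φ t < primitiveG g a := by
    have hc := (hg.continuous_primitiveG.continuousAt (x := α)).tendsto.mono_left
      (nhdsWithin_le_nhds (s := Iio α))
    obtain ⟨a, ha, ha'⟩ := ((hc.eventually_const_lt h2).and (Ioo_mem_nhdsLT h1)).exists
    exact ⟨a, ha'.1, ha'.2, ha⟩
  refine ⟨a, (abs_nonneg _).trans_lt ha1, ha2, fun r hr htr => ?_⟩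
  by_contra! hlt
  have hsub : Icc t r ⊆ J := hJ.out ht hr
  have hcont : ContinuousOn (fun s => |ψ s|) (Icc t r) := (h.continuousOn_left.mono hsub).abs
  obtain ⟨s, hs, hsa⟩ := intermediate_value_Icc htr hcont ⟨ha1.le, hlt.le⟩
  have hE := h.energy_antitoneOn hk hg hJ ht (hsub hs) hs.1
  have hG : primitiveG g a ≤ energy g ψ φ s := by
    simp only at hsa
    rw [energy, ← hg.primitiveG_abs (ψ s), hsa]
    nlinarith [sq_nonneg (φ s)]
  linarith

/-- A trapped solution tends to `0`. -/
lemma tendsto_zero (hk : 2 ≤ k) (hg : IsBistable g α β) {R a : ℝ} (ha0 : 0 < a) (ha : a < α)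
    (h : SolvesOn k g (Ioi R) ψ φ) (hle : ∀ r, R < r → |ψ r| ≤ a) : Tendsto ψ atTop (𝓝 0) := by
  obtain ⟨c, C, hc, hC, hb⟩ := hg.exists_quadratic_bounds ha0 ha
  have hE := h.energy_antitoneOn hk hg ordConnected_Ioi
  have hk2 : (2 : ℝ) ≤ k := by exact_mod_cast hk
  have hG0 : ∀ r, R < r → 0 ≤ primitiveG g (ψ r) := fun r hr =>
    hg.primitiveG_nonneg ((hle r hr).trans ha.le)
  have small : ∀ L > 0, ∃ r, R < r ∧ energy g ψ φ r < L := by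
    intro L hL
    by_contra! hno
    set D := 1 + C / c with hD
    have hD0 : 0 < D := by positivity
    set B := a ^ 2 + energy g ψ φ (R + 1) with hB
    have hprod : ∀ r, R + 1 ≤ r → |ψ r * φ r| ≤ B := fun r hr => by
      have h1 : energy g ψ φ r ≤ energy g ψ φ (R + 1) :=
        hE (show R < R + 1 by linarith) (show R < r by linarith) hr
      have h2 : φ r ^ 2 / 2 ≤ energy g ψ φ r := by
        rw [energy]; linarith [hG0 r (by linarith)]
      have h3 : ψ r ^ 2 ≤ a ^ 2 := sq_le_sq' (by linarith [(abs_le.1 (hle r (by linarith))).1])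
        (abs_le.1 (hle r (by linarith))).2
      rw [abs_le]
      constructor <;> nlinarith [sq_nonneg (ψ r + φ r), sq_nonneg (ψ r - φ r), sq_nonneg (ψ r)]
    have hB0 : 0 ≤ B := (abs_nonneg _).trans (hprod (R + 1) le_rfl)
    -- If the energy stays above `L`, then so does `φ²/2 + (C/2) ψ²`; the bound `c ψ² ≤ ψ g(ψ)`
    -- turns this into a lower bound for `φ² + ψ g(ψ)`.
    have hlow : ∀ r, R < r → L / D ≤ φ r ^ 2 + ψ r * g (ψ r) := fun r hr => by
      obtain ⟨b1, -, b3⟩ := hb (ψ r) (hle r hr)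
      have b4 := hno r hr
      rw [energy] at b4
      rw [div_le_iff₀ hD0, hD]
      have b5 : C * ψ r ^ 2 ≤ C / c * (ψ r * g (ψ r)) := by
        rw [div_mul_eq_mul_div, le_div_iff₀ hc]
        nlinarith
      have b6 : 0 ≤ ψ r * g (ψ r) := le_trans (by positivity) b1
      have b7 : 0 ≤ C / c * φ r ^ 2 := by positivity
      nlinarith [sq_nonneg (φ r), sq_nonneg (ψ r)]
    set m := L / D / 4 with hm
    have hm0 : 0 < m := by positivity
    set R₁ := max (R + 1) (max 1 (k * B / (2 * m))) with hR₁
    have hRR : ∀ r ∈ Ici R₁, R + 1 ≤ r := fun r hr => (le_max_left _ _).trans hr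
    have hR1 : ∀ r ∈ Ici R₁, 1 ≤ r := fun r hr =>
      (le_max_left _ _).trans ((le_max_right _ _).trans hr)
    -- The dissipation degenerates where `φ = 0`. The correction `ψ φ / (2 r)` contributes `-ψ g(ψ)
    -- / (2 r)` and `φ² / (2 r)`; as `k - 3/2 ≥ 1/2`, the leading part is at most `-(φ² + ψ g(ψ)) /
    -- (2 r) ≤ -2 m / r`. This absorbs the derivative of `m log r`, and the remaining `-m / r`
    -- absorbs the cross term of order `1 / r²`.
    have hanti : AntitoneOn
        (fun r => energy g ψ φ r + ψ r * φ r / (2 * r) + m * Real.log r) (Ici R₁) := by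
      refine antitoneOn_of_hasDerivAt_nonpos (f' := fun r =>
        -(((k : ℝ) - 1) / r * φ r ^ 2) + ((φ r * φ r + ψ r * (-(((k : ℝ) - 1) / r * φ r) - g (ψ r)))
          * (2 * r) - ψ r * φ r * (2 * 1)) / (2 * r) ^ 2 + m * r⁻¹)
        ordConnected_Ici (fun r hr => ?_) fun r hr => ?_
      · have hr0 : r ≠ 0 := by linarith [hR1 r hr]
        have hrR : r ∈ Ioi R := by
          have := hRR r hr
          exact show R < r by linarith
        obtain ⟨-, h1, h2⟩ := h r hrR
        exact ((h.hasDerivAt_energy hg hrR).add ((h1.mul h2).div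
          ((hasDerivAt_id r).const_mul 2) (mul_ne_zero two_ne_zero hr0))).add
          ((Real.hasDerivAt_log hr0).const_mul m)
      · have hr1 := hR1 r hr
        have hr0 : 0 < r := by linarith
        have e : -(((k : ℝ) - 1) / r * φ r ^ 2) +
            ((φ r * φ r + ψ r * (-(((k : ℝ) - 1) / r * φ r) - g (ψ r)))
            * (2 * r) - ψ r * φ r * (2 * 1)) / (2 * r) ^ 2 + m * r⁻¹ =
            (2 * r * (m - ((k : ℝ) - 3 / 2) * φ r ^ 2 - ψ r * g (ψ r) / 2) - k * (ψ r * φ r))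
              / (2 * r ^ 2) := by
          field_simp
          ring
        rw [e]
        refine div_nonpos_of_nonpos_of_nonneg ?_ (by positivity)
        have h1 := hlow r (by linarith [hRR r hr])
        have h2 := (abs_le.1 (hprod r (hRR r hr))).1
        have h3 : k * B / (2 * m) ≤ r := (le_max_right _ _).trans ((le_max_right _ _).trans hr)
        rw [div_le_iff₀ (by positivity)] at h3
        have h4 : m - ((k : ℝ) - 3 / 2) * φ r ^ 2 - ψ r * g (ψ r) / 2 ≤ -m := by
          have : L / D = 4 * m := by rw [hm]; ring
          nlinarith [sq_nonneg (φ r)]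
        have h5 : -(k * (ψ r * φ r)) ≤ k * B := by nlinarith
        nlinarith
    set A := energy g ψ φ R₁ + ψ R₁ * φ R₁ / (2 * R₁) + m * Real.log R₁
    obtain ⟨r, hr1, hr2⟩ := (((Real.tendsto_log_atTop.const_mul_atTop hm0).eventually_gt_atTop
      (A + B)).and (eventually_ge_atTop R₁)).exists
    have h1 : energy g ψ φ r + ψ r * φ r / (2 * r) + m * Real.log r ≤ A :=
      hanti self_mem_Ici hr2 hr2
    have h2 := hno r (by linarith [hRR r hr2])
    have h3 : -B ≤ ψ r * φ r / (2 * r) := by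
      have hr0 := hR1 r hr2
      rw [le_div_iff₀ (by linarith)]
      nlinarith [(abs_le.1 (hprod r (hRR r hr2))).1]
    linarith
  rw [Metric.tendsto_atTop]
  intro ε hε
  obtain ⟨r, hr, hr'⟩ := small (c / 2 * ε ^ 2) (by positivity)
  refine ⟨r, fun s hs => ?_⟩
  have hRs : R < s := hr.trans_le hs
  have h1 : energy g ψ φ s ≤ energy g ψ φ r := hE hr hRs hs
  have h2 := (hb (ψ s) (hle s hRs)).2.1
  have h3 : primitiveG g (ψ s) ≤ energy g ψ φ s := by
    rw [energy]; nlinarith [sq_nonneg (φ s)]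
  rw [Real.dist_eq, sub_zero]
  refine abs_lt_of_sq_lt_sq ?_ hε.le
  have : c / 2 * ψ s ^ 2 < c / 2 * ε ^ 2 := by linarith
  exact lt_of_mul_lt_mul_left this (by positivity)

end SolvesOn

lemma exists_tendsto_of_antitoneOn {f : ℝ → ℝ} {a b : ℝ} (hf : AntitoneOn f (Ici a))
    (hb : ∀ r, a ≤ r → b ≤ f r) :
    ∃ l, Tendsto f atTop (𝓝 l) ∧ b ≤ l ∧ ∀ r, a ≤ r → l ≤ f r := by
  have hanti : Antitone fun r => f (max r a) := fun x y hxy =>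
    hf (mem_Ici.2 (le_max_right _ _)) (mem_Ici.2 (le_max_right _ _)) (max_le_max_right a hxy)
  have hbdd : BddBelow (range fun r => f (max r a)) :=
    ⟨b, by rintro _ ⟨r, rfl⟩; exact hb _ (le_max_right _ _)⟩
  have hlim : Tendsto f atTop (𝓝 (⨅ r, f (max r a))) := by
    refine (tendsto_atTop_ciInf hanti hbdd).congr' ?_
    filter_upwards [eventually_ge_atTop a] with r hr
    rw [max_eq_left hr]
  refine ⟨_, hlim, ge_of_tendsto hlim ?_, fun r hr => le_of_tendsto hlim ?_⟩
  · filter_upwards [eventually_ge_atTop a] with r hr using hb r hr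
  · filter_upwards [eventually_ge_atTop r] with s hs using hf hr (hr.trans hs) hs

/-! ### Sign of the derivative and critical points -/

namespace SolvesOn

variable {k : ℕ} {g : ℝ → ℝ} {α β : ℝ} {J : Set ℝ} {ψ φ : ℝ → ℝ}

/-- The flux strictly decreases while `g(ψ) > 0`, so even a critical point at `s` is followed by a
negative derivative. -/
lemma right_neg_of_map_pos (hk : 2 ≤ k) (hJ : J.OrdConnected) (h : SolvesOn k g J ψ φ)
    {s r : ℝ} (hs : s ∈ J) (hr : r ∈ J) (hsr : s < r) (hφ : φ s ≤ 0)
    (hpos : ∀ u ∈ Ioo s r, 0 < g (ψ u)) : φ r < 0 := by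
  have hsub : Icc s r ⊆ J := hJ.out hs hr
  have hanti := strictAntiOn_of_hasDerivAt_neg ordConnected_Icc
    (fun u hu => h.hasDerivAt_flux hk (hsub hu)) (fun u hu => by
      rw [interior_Icc] at hu
      have h0 := (h u (hsub (Ioo_subset_Icc_self hu))).1
      have := mul_pos (pow_pos h0 (k - 1)) (hpos u hu)
      linarith)
  have hlt : r ^ (k - 1) * φ r < s ^ (k - 1) * φ s :=
    hanti (left_mem_Icc.2 hsr.le) (right_mem_Icc.2 hsr.le) hsr
  have h1 := pow_pos (h r hr).1 (k - 1)
  have h2 := pow_pos (h s hs).1 (k - 1)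
  by_contra! h3
  nlinarith [mul_nonneg h1.le h3]

lemma strictAntiOn_left {s r : ℝ} (hJ : J.OrdConnected) (h : SolvesOn k g J ψ φ) (hs : s ∈ J)
    (hr : r ∈ J) (hφ : ∀ u ∈ Ioo s r, φ u < 0) : StrictAntiOn ψ (Icc s r) :=
  strictAntiOn_of_hasDerivAt_neg ordConnected_Icc (fun u hu => (h u (hJ.out hs hr hu)).2.1)
    fun u hu => hφ u (by rwa [interior_Icc] at hu)

/-- As long as a solution starting downwards below `α` is positive, it decreases. -/
lemma right_neg_of_pos (hk : 2 ≤ k) (hg : IsBistable g α β) (hJ : J.OrdConnected)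
    (h : SolvesOn k g J ψ φ) {s b : ℝ} (hs : s ∈ J) (hb : b ∈ J) (hsb : s ≤ b)
    (hψ : ψ s < α) (hφ : φ s < 0) (hpos : ∀ r ∈ Ico s b, 0 < ψ r) : φ b < 0 := by
  by_contra! h0
  have hsub : Icc s b ⊆ J := hJ.out hs hb
  obtain ⟨t, ht, ht0, hlt⟩ := exists_first_zero hsb (h.continuousOn_right.mono hsub) hφ h0
  have htJ : t ∈ J := hsub (Ioc_subset_Icc_self ht)
  have hanti := h.strictAntiOn_left hJ hs htJ fun u hu => hlt u (Ioo_subset_Ico_self hu)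
  refine (h.right_neg_of_map_pos hk hJ hs htJ ht.1 hφ.le fun u hu => hg.pos _
    ⟨hpos u ⟨hu.1.le, hu.2.trans_le ht.2⟩, ?_⟩).ne ht0
  exact (hanti (left_mem_Icc.2 ht.1.le) (Ioo_subset_Icc_self hu) hu.1).trans hψ

/-- Without a next critical point `ψ` would decrease forever and keep a constant sign eventually,
which `not_forall_pos` forbids. The critical point is not reached with `ψ ≥ 0`, because the flux
decreases as long as `ψ > 0`. -/
lemma exists_next_critical_of_pos (hk : 2 ≤ k) (hg : IsBistable g α β) {s a : ℝ} (ha : a < α)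
    (h : SolvesOn k g (Ici s) ψ φ) (hle : ∀ r, s ≤ r → |ψ r| ≤ a) (hφ : φ s ≤ 0)
    (hψ : 0 < ψ s) : ∃ t, s < t ∧ φ t = 0 ∧ ψ t < 0 ∧ ∀ r ∈ Ioo s t, φ r < 0 := by
  have hlt : ∀ r, s ≤ r → ψ r < α := fun r hr => (abs_le.1 (hle r hr)).2.trans_lt ha
  obtain ⟨δ, hδ, hnear⟩ : ∃ δ > 0, ∀ u, |u - s| < δ → 0 < ψ u :=
    Metric.eventually_nhds_iff.1
      (continuousAt_const.eventually_lt (h s self_mem_Ici).2.1.continuousAt hψ)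
  -- Since `φ s = 0` is allowed, `exists_first_zero` cannot start at `s`; the search starts at `s +
  -- δ / 2`, where `φ` is already negative.
  have hstart : ∀ r, s < r → r < s + δ → φ r < 0 := fun r h1 h2 =>
    h.right_neg_of_map_pos hk ordConnected_Ici self_mem_Ici h1.le h1 hφ fun u hu =>
      hg.pos _ ⟨hnear u (by rw [abs_lt]; constructor <;> linarith [hu.1, hu.2]),
        hlt u hu.1.le⟩
  have hex : ∃ b, s + δ / 2 ≤ b ∧ 0 ≤ φ b := by
    by_contra! hno
    have hneg : ∀ r, s < r → φ r < 0 := fun r hr => by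
      rcases lt_or_ge r (s + δ / 2) with h1 | h1
      · exact hstart r hr (by linarith)
      · exact hno r h1
    have hanti : StrictAntiOn ψ (Ici s) :=
      strictAntiOn_of_hasDerivAt_neg ordConnected_Ici (fun u hu => (h u hu).2.1)
        fun u hu => hneg u (by rwa [interior_Ici] at hu)
    by_cases hall : ∀ r, s < r → 0 < ψ r
    · exact (h.mono Ioi_subset_Ici_self).not_forall_pos hg ha hall
        fun r hr => (abs_le.1 (hle r hr.le)).2
    · push Not at hall
      obtain ⟨z, hz, hz0⟩ := hall
      have hsub : Ioi z ⊆ Ici s := fun r hr => hz.le.trans (le_of_lt hr)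
      refine ((h.mono hsub).neg hg).not_forall_pos hg ha (fun r hr => ?_) fun r hr => ?_
      · have : ψ r < ψ z := hanti hz.le (hz.le.trans hr.le) hr
        linarith
      · linarith [(abs_le.1 (hle r (hz.le.trans hr.le))).1]
  obtain ⟨b, hb, hb0⟩ := hex
  have hsub : Icc (s + δ / 2) b ⊆ Ici s := fun r hr => show s ≤ r by linarith [hr.1]
  obtain ⟨t, ht, ht0, hbefore⟩ := exists_first_zero hb (h.continuousOn_right.mono hsub)
    (hstart _ (by linarith) (by linarith)) hb0
  have hst : s < t := by linarith [ht.1]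
  have hneg : ∀ r ∈ Ioo s t, φ r < 0 := fun r hr => by
    rcases lt_or_ge r (s + δ / 2) with h1 | h1
    · exact hstart r hr.1 (by linarith)
    · exact hbefore r ⟨h1, hr.2⟩
  refine ⟨t, hst, ht0, ?_, hneg⟩
  by_contra! h0
  have hanti := h.strictAntiOn_left ordConnected_Ici self_mem_Ici hst.le hneg
  refine (h.right_neg_of_map_pos hk ordConnected_Ici self_mem_Ici hst.le hst hφ fun u hu =>
    hg.pos _ ⟨h0.trans_lt ?_, hlt u hu.1.le⟩).ne ht0
  exact hanti (Ioo_subset_Icc_self hu) (right_mem_Icc.2 hst.le) hu.2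

/-- The next critical point of a trapped solution, across which the solution changes sign. -/
lemma exists_next_critical (hk : 2 ≤ k) (hg : IsBistable g α β) {s a : ℝ} (ha : a < α)
    (h : SolvesOn k g (Ici s) ψ φ) (hle : ∀ r, s ≤ r → |ψ r| ≤ a) (hφ : φ s * ψ s ≤ 0)
    (hψ : ψ s ≠ 0) : ∃ t, s < t ∧ φ t = 0 ∧ ψ s * ψ t < 0 ∧
      ((∀ r ∈ Ioo s t, φ r < 0) ∨ ∀ r ∈ Ioo s t, 0 < φ r) := by
  rcases lt_or_gt_of_ne hψ with h0 | h0
  · obtain ⟨t, h1, h2, h3, h4⟩ := (h.neg hg).exists_next_critical_of_pos hk hg ha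
      (by simpa only [abs_neg] using hle) (by nlinarith) (by linarith)
    exact ⟨t, h1, by linarith, by nlinarith, Or.inr fun r hr => by linarith [h4 r hr]⟩
  · obtain ⟨t, h1, h2, h3, h4⟩ := h.exists_next_critical_of_pos hk hg ha hle (by nlinarith) h0
    exact ⟨t, h1, h2, by nlinarith, Or.inl h4⟩

/-- The sequence of critical points of a trapped solution. -/
lemma exists_critical_seq (hk : 2 ≤ k) (hg : IsBistable g α β) {r₀ a : ℝ} (ha : a < α)
    (h : SolvesOn k g (Ici r₀) ψ φ) (hle : ∀ r, r₀ ≤ r → |ψ r| ≤ a) (hφ : φ r₀ * ψ r₀ ≤ 0)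
    (hψ : ψ r₀ ≠ 0) : ∃ s : ℕ → ℝ, s 0 = r₀ ∧ StrictMono s ∧ Tendsto s atTop atTop ∧
      (∀ n, ψ (s n) * ψ (s (n + 1)) < 0) ∧
      ∀ n, (∀ r ∈ Ioo (s n) (s (n + 1)), φ r < 0) ∨ ∀ r ∈ Ioo (s n) (s (n + 1)), 0 < φ r := by
  have hstep : ∀ s, (r₀ ≤ s ∧ φ s * ψ s ≤ 0 ∧ ψ s ≠ 0) → ∃ t, s < t ∧ φ t = 0 ∧ ψ s * ψ t < 0 ∧
      ((∀ r ∈ Ioo s t, φ r < 0) ∨ ∀ r ∈ Ioo s t, 0 < φ r) := fun s hs =>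
    (h.mono (Ici_subset_Ici.2 hs.1)).exists_next_critical hk hg ha
      (fun r hr => hle r (hs.1.trans hr)) hs.2.1 hs.2.2
  choose! nxt h1 h2 h3 h4 using hstep
  let s : ℕ → ℝ := fun n => nxt^[n] r₀
  have hsucc : ∀ n, s (n + 1) = nxt (s n) := fun n => Function.iterate_succ_apply' _ _ _
  -- The invariant is `φ ψ ≤ 0` rather than `φ = 0`, so that the sequence may start at a noncritical
  -- point.
  have hQ : ∀ n, r₀ ≤ s n ∧ φ (s n) * ψ (s n) ≤ 0 ∧ ψ (s n) ≠ 0 := by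
    intro n
    induction n with
    | zero => exact ⟨le_rfl, hφ, hψ⟩
    | succ n ih =>
      rw [hsucc]
      refine ⟨ih.1.trans (h1 _ ih).le, by rw [h2 _ ih, zero_mul], fun h0 => ?_⟩
      have := h3 _ ih
      rw [h0, mul_zero] at this
      exact this.false
  have hmono : StrictMono s := strictMono_nat_of_lt_succ fun n => by
    rw [hsucc]; exact h1 _ (hQ n)
  have hprod : ∀ n, ψ (s n) * ψ (s (n + 1)) < 0 := fun n => by
    rw [hsucc]; exact h3 _ (hQ n)
  refine ⟨s, rfl, hmono, ?_, hprod, fun n => by rw [hsucc]; exact h4 _ (hQ n)⟩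
  -- At a finite accumulation point both `ψ` (by the sign changes) and `φ` would vanish, and
  -- uniqueness would make the solution identically zero.
  rcases tendsto_atTop_of_monotone hmono.monotone with hlim | ⟨l, hl⟩
  · exact hlim
  exfalso
  have hrl : r₀ ≤ l := ge_of_tendsto' hl fun n => (hQ n).1
  have hl1 : Tendsto (fun n => s (n + 1)) atTop (𝓝 l) := hl.comp (tendsto_add_atTop_nat 1)
  have cψ : Tendsto ψ (𝓝 l) (𝓝 (ψ l)) := (h l hrl).2.1.continuousAt
  have cφ : Tendsto φ (𝓝 l) (𝓝 (φ l)) := (h l hrl).2.2.continuousAt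
  have e1 : ψ l = 0 := by
    have : ψ l * ψ l ≤ 0 :=
      le_of_tendsto' ((cψ.comp hl).mul (cψ.comp hl1)) fun n => (hprod n).le
    exact mul_self_eq_zero.1 (this.antisymm (mul_self_nonneg _))
  have e2 : φ l = 0 :=
    tendsto_nhds_unique (cφ.comp hl1) (tendsto_const_nhds.congr fun n => by
      simp only [Function.comp_apply, hsucc]
      exact (h2 _ (hQ n)).symm)
  have := h.eq_of_equilibrium hg ordConnected_Ici hrl e2 (by rw [e1, hg.map_zero])
    (r := r₀) self_mem_Ici
  exact hψ (this.trans e1)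

/-- A solution which gets below `-α` decreases all the time. -/
lemma right_neg_of_lt_neg_alpha (hk : 2 ≤ k) (hg : IsBistable g α β) (hJ : J.OrdConnected)
    (h : SolvesOn k g J ψ φ) {r₀ r₂ : ℝ} (hr₀ : r₀ ∈ J) (hψ : ψ r₀ ∈ Ioo (-α) α)
    (hφ : φ r₀ < 0) (hr₂ : r₂ ∈ J) (hr₀₂ : r₀ ≤ r₂) (hlt : ψ r₂ < -α) {r : ℝ}
    (hr : r ∈ J) (hle : r₀ ≤ r) : φ r < 0 := by
  by_contra! h0
  have hsub : Icc r₀ r ⊆ J := hJ.out hr₀ hr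
  obtain ⟨t, ht, ht0, hbefore⟩ := exists_first_zero hle (h.continuousOn_right.mono hsub) hφ h0
  have htJ : t ∈ J := hsub (Ioc_subset_Icc_self ht)
  have hanti := h.strictAntiOn_left hJ hr₀ htJ fun u hu => hbefore u (Ioo_subset_Ico_self hu)
  have htlt : ψ t < ψ r₀ := hanti (left_mem_Icc.2 ht.1.le) (right_mem_Icc.2 ht.1.le) ht.1
  -- At the first critical point `t`: below `-α`, the flux has been decreasing since the crossing of
  -- `-α`, so `φ t < 0`; at `-α`, the solution is constant; above `-α`, the energy `G(ψ t) < G(α)`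
  -- prevents any later crossing, and monotonicity prevents an earlier one.
  rcases lt_trichotomy (ψ t) (-α) with h1 | h1 | h1
  · have hsub' : Icc r₀ t ⊆ J := hJ.out hr₀ htJ
    obtain ⟨q, hq, hqα⟩ := intermediate_value_Icc' ht.1.le (h.continuousOn_left.mono hsub')
      (show -α ∈ Icc (ψ t) (ψ r₀) from ⟨h1.le, hψ.1.le⟩)
    have hqt : q < t := lt_of_le_of_ne hq.2 fun e => by rw [e] at hqα; linarith
    refine (h.right_neg_of_map_pos hk hJ (hsub' hq) htJ hqt (hbefore q ⟨hq.1, hqt⟩).le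
      fun u hu => hg.pos_of_lt_neg_alpha ?_).ne ht0
    rw [← hqα]
    exact hanti hq ⟨hq.1.trans hu.1.le, hu.2.le⟩ hu.1
  · have := h.eq_of_equilibrium hg hJ htJ ht0 (by rw [h1, hg.map_neg_alpha]) hr₀
    linarith
  · have habs : |ψ t| < α := abs_lt.2 ⟨h1, htlt.trans hψ.2⟩
    obtain ⟨a, -, ha, hbd⟩ := h.trapped hk hg hJ htJ habs (by
      rw [energy, ht0]
      linarith [hg.primitiveG_lt habs])
    rcases le_total t r₂ with h2 | h2
    · linarith [(abs_le.1 (hbd r₂ hr₂ h2)).1]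
    · have := hanti.antitoneOn ⟨hr₀₂, h2⟩ (right_mem_Icc.2 ht.1.le) h2
      linarith

end SolvesOn

/-! ### Thresholds: trapping below, crossing above -/

/-- The lower threshold. -/
noncomputable def lowerRadius (k : ℕ) (g : ℝ → ℝ) (α β : ℝ) : ℝ :=
  k * √2 / g β * √(primitiveG g α - 1 / k * primitiveG g β)

/-- The upper threshold. -/
noncomputable def upperRadius (k : ℕ) (g : ℝ → ℝ) (α β : ℝ) : ℝ :=
  k * √2 / g β * √(primitiveG g α - primitiveG g β + ((k : ℝ) - 1) / k * g β * (α + β))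

namespace IsMaximalSolution

variable {k : ℕ} {g : ℝ → ℝ} {α β r₀ : ℝ} {J : Set ℝ} {ψ : ℝ → ℝ}

/-- A bound on `ψ` suffices: the decreasing energy then bounds `ψ'`, as `G` is bounded on `[-M, M]`.
-/
lemma Ioi_subset_of_abs_le (hk : 2 ≤ k) (hg : IsBistable g α β) {ξ θ M : ℝ}
    (h : IsMaximalSolution k g r₀ ξ θ J ψ) (hM : ∀ r ∈ J, r₀ ≤ r → |ψ r| ≤ M) : Ioi r₀ ⊆ J := by
  obtain ⟨N, hN⟩ := isCompact_Icc.exists_bound_of_continuousOn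
    (hg.continuous_primitiveG.continuousOn (s := Icc (-M) M))
  set E := energy g ψ (deriv ψ) r₀
  refine h.Ioi_subset hg.contDiff (M := max M (1 + 2 * (E + N))) fun r hr hle =>
    ⟨(hM r hr hle).trans (le_max_left _ _), le_trans ?_ (le_max_right _ _)⟩
  have h1 : energy g ψ (deriv ψ) r ≤ E :=
    h.1.solvesOn.energy_antitoneOn hk hg h.1.ordConnected h.1.mem hr hle
  have h2 := (abs_le.1 (hN (ψ r) (abs_le.1 (hM r hr hle)))).1
  rw [energy] at h1
  have h3 : deriv ψ r ^ 2 ≤ 2 * (E + N) := by linarith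
  rw [← sq_abs] at h3
  nlinarith [sq_nonneg (|deriv ψ r| - 1), abs_nonneg (deriv ψ r)]

lemma init_deriv_neg (hk : 2 ≤ k) (hg : IsBistable g α β)
    (h : IsMaximalSolution k g r₀ β (-(g β / k) * r₀) J ψ) : deriv ψ r₀ < 0 := by
  rw [h.1.init_deriv]
  have h1 := hg.map_beta_pos
  have h2 := h.1.pos
  have h3 : (0 : ℝ) < k := by
    have : 0 < k := by lia
    exact_mod_cast this
  have : 0 < g β / k * r₀ := by positivity
  linarith

/-- Comparison with a constant forcing `c`, whose flux is `-c r^k / k`: the difference is monotone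
once `g(ψ)` lies on one side of `c`. -/
lemma hasDerivAt_flux_add (hk : 2 ≤ k)
    (h : IsMaximalSolution k g r₀ β (-(g β / k) * r₀) J ψ) {c r : ℝ} (hr : r ∈ J) :
    HasDerivAt (fun r => r ^ (k - 1) * deriv ψ r + c * (r ^ k / k))
      (r ^ (k - 1) * (c - g (ψ r))) r := by
  have hk0 : (k : ℝ) ≠ 0 := by
    have : k ≠ 0 := by lia
    exact_mod_cast this
  refine ((h.1.solvesOn.hasDerivAt_flux hk hr).add
    (((hasDerivAt_pow k r).div_const (k : ℝ)).const_mul c)).congr_deriv ?_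
  field_simp
  ring

lemma flux_add_init (hk : 2 ≤ k)
    (h : IsMaximalSolution k g r₀ β (-(g β / k) * r₀) J ψ) (c : ℝ) :
    r₀ ^ (k - 1) * deriv ψ r₀ + c * (r₀ ^ k / k) = (c - g β) * (r₀ ^ k / k) := by
  rw [h.1.init_deriv, show r₀ ^ k = r₀ ^ (k - 1) * r₀ by rw [← pow_succ]; congr 1; lia]
  ring

/-- Below the lower threshold the solution is trapped in a compact subset of `(-α, α)`. -/
lemma exists_abs_le_of_lt (hk : 2 ≤ k) (hg : IsBistable g α β)
    (h : IsMaximalSolution k g r₀ β (-(g β / k) * r₀) J ψ)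
    (hr₀ : r₀ < lowerRadius k g α β) :
    ∃ a, 0 < a ∧ a < α ∧ ∀ r ∈ J, r₀ ≤ r → |ψ r| ≤ a := by
  have hs := h.1.solvesOn
  have hJ := h.1.ordConnected
  have hβα : ψ r₀ < α := h.1.init.trans_lt hg.beta_lt_alpha
  have hφ₀ := h.init_deriv_neg hk hg
  have hkpos : (0 : ℝ) < k := by
    have : 0 < k := by lia
    exact_mod_cast this
  have hk1 : (1 : ℝ) ≤ k := by exact_mod_cast (by lia : 1 ≤ k)
  have hdown : ∀ b ∈ J, r₀ ≤ b → (∀ r ∈ Ico r₀ b, 0 < ψ r) → ∀ r ∈ Icc r₀ b,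
      deriv ψ r < 0 := fun b hb hle hpos r hr =>
    hs.right_neg_of_pos hk hg hJ h.1.mem (hJ.out h.1.mem hb hr) hr.1 hβα hφ₀
      fun u hu => hpos u ⟨hu.1, hu.2.trans_le hr.2⟩
  have hleβ : ∀ b ∈ J, r₀ ≤ b → (∀ r ∈ Ico r₀ b, 0 < ψ r) → ψ b ≤ β := fun b hb hle hpos => by
    rw [← h.1.init]
    exact (hs.strictAntiOn_left hJ h.1.mem hb fun u hu => hdown b hb hle hpos u
      (Ioo_subset_Icc_self hu)).antitoneOn (left_mem_Icc.2 hle) (right_mem_Icc.2 hle) hle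
  by_cases hall : ∀ r ∈ J, r₀ ≤ r → 0 < ψ r
  · refine ⟨β, hg.beta_pos, hg.beta_lt_alpha, fun r hr hle => ?_⟩
    rw [abs_of_pos (hall r hr hle)]
    exact hleβ r hr hle fun u hu => hall u (hJ.out h.1.mem hr (Ico_subset_Icc_self hu)) hu.1
  push Not at hall
  obtain ⟨b, hb, hle, hb0⟩ := hall
  have hsubb : Icc r₀ b ⊆ J := hJ.out h.1.mem hb
  obtain ⟨t, ht, ht0, hpos⟩ := exists_first_zero (f := fun r => -ψ r) hle
    (hs.continuousOn_left.mono hsubb).neg (by rw [h.1.init]; linarith [hg.beta_pos])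
    (by linarith)
  replace ht0 : ψ t = 0 := by linarith
  replace hpos : ∀ r ∈ Ico r₀ t, 0 < ψ r := fun r hr => by linarith [hpos r hr]
  have htJ : t ∈ J := hsubb (Ioc_subset_Icc_self ht)
  have hsub : Icc r₀ t ⊆ J := hJ.out h.1.mem htJ
  have hφ : ∀ r ∈ Icc r₀ t, deriv ψ r < 0 := hdown t htJ ht.1.le hpos
  have hanti : AntitoneOn ψ (Icc r₀ t) := (hs.strictAntiOn_left hJ h.1.mem htJ fun u hu =>
    hφ u (Ioo_subset_Icc_self hu)).antitoneOn
  have hrange : ∀ r ∈ Icc r₀ t, ψ r ∈ Icc 0 β := fun r hr => by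
    have h1 := hanti hr (right_mem_Icc.2 ht.1.le) hr.2
    have h2 := hanti (left_mem_Icc.2 ht.1.le) hr hr.1
    rw [ht0] at h1
    rw [h.1.init] at h2
    exact ⟨h1, h2⟩
  -- Comparison with the constant `g (ψ r)`, frozen at the final point: `g (ψ u)` decreases in `u`
  -- because `ψ` decreases within `[0, β]`, where `g` increases.
  have hslope : ∀ r ∈ Icc r₀ t, deriv ψ r + g (ψ r) / k * r ≤ 0 := fun r hr => by
    have hsubr : Icc r₀ r ⊆ Icc r₀ t := Icc_subset_Icc_right hr.2
    have hmono := antitoneOn_of_hasDerivAt_nonpos ordConnected_Icc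
      (fun u hu => h.hasDerivAt_flux_add hk (c := g (ψ r)) (hsub (hsubr hu))) (fun u hu => by
        have h1 := hg.monotoneOn (hrange r hr) (hrange u (hsubr hu)) (hanti (hsubr hu) hr hu.2)
        have h2 := pow_pos (hs u (hsub (hsubr hu))).1 (k - 1)
        exact mul_nonpos_of_nonneg_of_nonpos h2.le (by linarith))
      (left_mem_Icc.2 hr.1) (right_mem_Icc.2 hr.1) hr.1
    simp only [h.flux_add_init hk] at hmono
    have h1 := hg.monotoneOn (hrange r hr) ⟨hg.beta_pos.le, le_rfl⟩ (hrange r hr).2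
    have h2 : (g (ψ r) - g β) * (r₀ ^ k / k) ≤ 0 :=
      mul_nonpos_of_nonpos_of_nonneg (by linarith) (by have := h.1.pos; positivity)
    have hr0 := pow_pos (hs r (hsub hr)).1 (k - 1)
    have h3 : r ^ (k - 1) * (deriv ψ r + g (ψ r) / k * r) ≤ 0 := by
      refine le_trans (le_of_eq ?_) (hmono.trans h2)
      rw [show r ^ k = r ^ (k - 1) * r by rw [← pow_succ]; congr 1; lia]
      ring
    by_contra! h4
    exact absurd (mul_pos hr0 h4) (not_lt.2 h3)
  -- The derivative is `-((k-1)/r) ψ' (ψ' + g(ψ) r / k) ≤ 0`. As `G(0) = 0`, the energy at `t` is at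
  -- most `ψ'(r₀)²/2 + G(β)/k`, which is below `G(α)` exactly when `r₀` is below the lower
  -- threshold.
  have hH := antitoneOn_of_hasDerivAt_nonpos (S := Icc r₀ t)
    (f := fun r => energy g ψ (deriv ψ) r - ((k : ℝ) - 1) / k * primitiveG g (ψ r))
    (f' := fun r => -(((k : ℝ) - 1) / r * deriv ψ r ^ 2)
      - ((k : ℝ) - 1) / k * (g (ψ r) * deriv ψ r)) ordConnected_Icc
    (fun r hr => (hs.hasDerivAt_energy hg (hsub hr)).sub
      (((hg.hasDerivAt_primitiveG (ψ r)).comp r (hs r (hsub hr)).2.1).const_mul _))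
    (fun r hr => by
      have hr0 : 0 < r := h.1.subset_pos (hsub hr)
      have e : -(((k : ℝ) - 1) / r * deriv ψ r ^ 2) - ((k : ℝ) - 1) / k * (g (ψ r) * deriv ψ r) =
          -(((k : ℝ) - 1) / r * (deriv ψ r * (deriv ψ r + g (ψ r) / k * r))) := by
        field_simp
        ring
      rw [e, Left.neg_nonpos_iff]
      exact mul_nonneg (div_nonneg (by linarith) hr0.le)
        (mul_nonneg_of_nonpos_of_nonpos (hφ r hr).le (hslope r hr)))
    (left_mem_Icc.2 ht.1.le) (right_mem_Icc.2 ht.1.le) ht.1.le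
  have hE : energy g ψ (deriv ψ) t < primitiveG g α := by
    simp only [energy, ht0, IsBistable.primitiveG_zero, h.1.init, h.1.init_deriv] at hH ⊢
    have hb := hg.map_beta_pos
    rw [lowerRadius] at hr₀
    have h1 : g β / k * r₀ < √2 * √(primitiveG g α - 1 / k * primitiveG g β) := by
      calc _ < g β / k * (k * √2 / g β * √(primitiveG g α - 1 / k * primitiveG g β)) := by
            gcongr
        _ = _ := by field_simp
    rw [← Real.sqrt_mul (by norm_num)] at h1
    have h2 : (g β / k * r₀) ^ 2 < 2 * (primitiveG g α - 1 / k * primitiveG g β) :=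
      (Real.lt_sqrt (by have := h.1.pos; positivity)).1 h1
    have e : ((k : ℝ) - 1) / k = 1 - 1 / k := by field_simp
    rw [e] at hH
    nlinarith
  obtain ⟨a, ha0, ha, hbd⟩ := hs.trapped hk hg hJ htJ (by rw [ht0, abs_zero]; exact hg.alpha_pos) hE
  refine ⟨max a β, lt_max_of_lt_left ha0, max_lt ha hg.beta_lt_alpha, fun r hr hle => ?_⟩
  rcases le_total t r with h1 | h1
  · exact (hbd r hr h1).trans (le_max_left _ _)
  · obtain ⟨h2, h3⟩ := hrange r ⟨hle, h1⟩
    rw [abs_of_nonneg h2]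
    exact h3.trans (le_max_right _ _)

/-- Above the upper threshold the solution gets below `-α`. -/
lemma exists_lt_neg_alpha (hk : 2 ≤ k) (hg : IsBistable g α β)
    (h : IsMaximalSolution k g r₀ β (-(g β / k) * r₀) J ψ)
    (hr₀ : upperRadius k g α β < r₀) : ∃ r ∈ J, r₀ < r ∧ ψ r < -α := by
  by_contra! hno
  have hs := h.1.solvesOn
  have hJ := h.1.ordConnected
  have hφ₀ := h.init_deriv_neg hk hg
  have hkpos : (0 : ℝ) < k := by
    have : 0 < k := by lia
    exact_mod_cast this
  have hk1 : (1 : ℝ) ≤ k := by exact_mod_cast (by lia : 1 ≤ k)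
  have hb := hg.map_beta_pos
  have hα := hg.alpha_pos
  have hβα := hg.beta_lt_alpha
  have hβ := hg.beta_pos
  set κ : ℝ := ((k : ℝ) - 1) / k * g β
  have hκ : 0 ≤ κ := mul_nonneg (div_nonneg (by linarith) hkpos.le) hb.le
  -- The surplus `μ` is what remains of the initial energy after the barrier `G(α)` and the largest
  -- loss `κ (α + β)`; its positivity is the condition on `r₀`.
  obtain ⟨μ, hμ, hμE⟩ : ∃ μ > 0,
      energy g ψ (deriv ψ) r₀ = primitiveG g α + κ * (α + β) + μ := by
    refine ⟨energy g ψ (deriv ψ) r₀ - (primitiveG g α + κ * (α + β)), ?_, by ring⟩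
    rw [energy, h.1.init, h.1.init_deriv]
    rw [upperRadius] at hr₀
    have h1 : √2 * √(primitiveG g α - primitiveG g β + κ * (α + β)) < g β / k * r₀ := by
      calc _ = g β / k * (k * √2 / g β *
            √(primitiveG g α - primitiveG g β + κ * (α + β))) := by field_simp
        _ < _ := by gcongr
    rw [← Real.sqrt_mul (by norm_num)] at h1
    have h2 := (Real.sqrt_lt' (by have := h.1.pos; positivity)).1 h1
    nlinarith
  -- The sign of `ψ'` is assumed only before `b`, so that `b` may be the first critical point, whose
  -- existence is refuted below.
  have hlow : ∀ b ∈ J, r₀ ≤ b → (∀ u ∈ Ioo r₀ b, deriv ψ u < 0) →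
      ψ b ∈ Icc (-α) β ∧ primitiveG g α + μ ≤ energy g ψ (deriv ψ) b := by
    intro b hbJ hle hneg
    have hsub : Icc r₀ b ⊆ J := hJ.out h.1.mem hbJ
    have hanti := (hs.strictAntiOn_left hJ h.1.mem hbJ hneg).antitoneOn
    have hrange : ∀ u ∈ Icc r₀ b, ψ u ∈ Icc (-α) β := fun u hu => by
      have h2 := hanti (left_mem_Icc.2 hle) hu hu.1
      rw [h.1.init] at h2
      refine ⟨?_, h2⟩
      rcases hu.1.eq_or_lt with rfl | h3
      · rw [h.1.init]; linarith
      · exact hno u (hsub hu) h3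
    have hneg' : ∀ u ∈ Ioo r₀ b, deriv ψ u ≤ 0 := fun u hu => (hneg u hu).le
    have hslope : ∀ r ∈ Icc r₀ b, 0 ≤ deriv ψ r + g β / k * r := fun r hr => by
      have hsubr : Icc r₀ r ⊆ Icc r₀ b := Icc_subset_Icc_right hr.2
      have hmono := monotoneOn_of_hasDerivAt_nonneg ordConnected_Icc
        (fun u hu => h.hasDerivAt_flux_add hk (c := g β) (hsub (hsubr hu))) (fun u hu => by
          have h1 := hg.le_map_beta (hrange u (hsubr hu))
          have h2 := pow_pos (hs u (hsub (hsubr hu))).1 (k - 1)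
          exact mul_nonneg h2.le (by linarith))
        (left_mem_Icc.2 hr.1) (right_mem_Icc.2 hr.1) hr.1
      simp only [h.flux_add_init hk, sub_self, zero_mul] at hmono
      have hr0 := pow_pos (hs r (hsub hr)).1 (k - 1)
      have h3 : 0 ≤ r ^ (k - 1) * (deriv ψ r + g β / k * r) := by
        refine hmono.trans (le_of_eq ?_)
        rw [show r ^ k = r ^ (k - 1) * r by rw [← pow_succ]; congr 1; lia]
        ring
      by_contra! h4
      exact absurd (mul_neg_of_pos_of_neg hr0 h4) (not_lt.2 h3)
    have hle0 : ∀ u ∈ Icc r₀ b, deriv ψ u ≤ 0 := fun u hu => by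
      rcases hu.1.eq_or_lt with rfl | h1
      · exact hφ₀.le
      rcases hu.2.lt_or_eq with h2 | rfl
      · exact hneg' u ⟨h1, h2⟩
      · have hc : Tendsto (deriv ψ) (𝓝[<] u) (𝓝 (deriv ψ u)) :=
          (hs u (hsub hu)).2.2.continuousAt.tendsto.mono_left nhdsWithin_le_nhds
        refine le_of_tendsto hc ?_
        filter_upwards [Ioo_mem_nhdsLT h1] with v hv using hneg' v hv
    -- The derivative is `-((k-1)/r) ψ' (ψ' + g(β) r / k) ≥ 0`, so the energy lost is at most `κ`
    -- times the drop of `ψ`, itself at most `α + β`.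
    have hK := monotoneOn_of_hasDerivAt_nonneg (S := Icc r₀ b)
      (f := fun r => energy g ψ (deriv ψ) r - κ * ψ r)
      (f' := fun r => -(((k : ℝ) - 1) / r * deriv ψ r ^ 2) - κ * deriv ψ r) ordConnected_Icc
      (fun r hr => (hs.hasDerivAt_energy hg (hsub hr)).sub ((hs r (hsub hr)).2.1.const_mul κ))
      (fun r hr => by
        have hr0 : 0 < r := h.1.subset_pos (hsub hr)
        have e : -(((k : ℝ) - 1) / r * deriv ψ r ^ 2) - κ * deriv ψ r =
            ((k : ℝ) - 1) / r * (-deriv ψ r * (deriv ψ r + g β / k * r)) := by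
          simp only [κ]
          field_simp
          ring
        rw [e]
        exact mul_nonneg (div_nonneg (by linarith) hr0.le)
          (mul_nonneg (by linarith [hle0 r hr]) (hslope r hr)))
      (left_mem_Icc.2 hle) (right_mem_Icc.2 hle) hle
    have hbr := hrange b (right_mem_Icc.2 hle)
    refine ⟨hbr, ?_⟩
    simp only [h.1.init, hμE] at hK
    nlinarith [mul_nonneg hκ (sub_nonneg.2 hbr.1)]
  have hneg : ∀ r ∈ J, r₀ ≤ r → deriv ψ r < 0 := by
    intro r hr hle
    by_contra! h0
    have hsub : Icc r₀ r ⊆ J := hJ.out h.1.mem hr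
    obtain ⟨t, ht, ht0, hbefore⟩ :=
      exists_first_zero hle (hs.continuousOn_right.mono hsub) hφ₀ h0
    obtain ⟨h1, h2⟩ := hlow t (hsub (Ioc_subset_Icc_self ht)) ht.1.le
      fun u hu => hbefore u (Ioo_subset_Ico_self hu)
    rw [energy, ht0] at h2
    have := hg.primitiveG_le (abs_le.2 ⟨h1.1, h1.2.trans hβα.le⟩)
    linarith
  have hlow' : ∀ b ∈ J, r₀ ≤ b →
      ψ b ∈ Icc (-α) β ∧ primitiveG g α + μ ≤ energy g ψ (deriv ψ) b := fun b hbJ hle =>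
    hlow b hbJ hle fun u hu => hneg u (hJ.out h.1.mem hbJ (Ioo_subset_Icc_self hu)) hu.1.le
  have habs : ∀ r ∈ J, r₀ ≤ r → |ψ r| ≤ α := fun r hr hle =>
    abs_le.2 ⟨(hlow' r hr hle).1.1, (hlow' r hr hle).1.2.trans hβα.le⟩
  have hglob := h.Ioi_subset_of_abs_le hk hg habs
  have hm : 0 < √(2 * μ) := Real.sqrt_pos.2 (by linarith)
  -- The energy exceeds `G(ψ)` by at least `μ`, so `ψ` falls at a uniform speed and cannot stay
  -- above `-α`.
  have hspeed : ∀ r ∈ J, r₀ ≤ r → deriv ψ r ≤ -√(2 * μ) := fun r hr hle => by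
    have h1 := (hlow' r hr hle).2
    have h2 := hg.primitiveG_le (habs r hr hle)
    rw [energy] at h1
    have h3 : √(2 * μ) ≤ |deriv ψ r| := Real.sqrt_le_iff.2
      ⟨abs_nonneg _, by rw [sq_abs]; linarith⟩
    rw [abs_of_neg (hneg r hr hle)] at h3
    linarith
  have hIci : Ici r₀ ⊆ J := fun r hr => by
    rcases (mem_Ici.1 hr).eq_or_lt with rfl | h1
    · exact h.1.mem
    · exact hglob h1
  have hanti := antitoneOn_of_hasDerivAt_nonpos (f := fun r => ψ r + √(2 * μ) * r)
    (f' := fun r => deriv ψ r + √(2 * μ) * 1) ordConnected_Ici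
    (fun r hr => (hs r (hIci hr)).2.1.add ((hasDerivAt_id r).const_mul _))
    (fun r hr => by linarith [hspeed r (hIci hr) hr])
  obtain ⟨r, hr1, hr2⟩ := (((tendsto_id.const_mul_atTop hm).eventually_gt_atTop
    (β + √(2 * μ) * r₀ + α)).and (eventually_gt_atTop r₀)).exists
  have h1 : ψ r + √(2 * μ) * r ≤ ψ r₀ + √(2 * μ) * r₀ := hanti self_mem_Ici hr2.le hr2.le
  rw [h.1.init] at h1
  simp only [id] at hr1
  linarith [hno r (hglob hr2) hr2]

lemma init_mem_Ioo (hg : IsBistable g α β)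
    (h : IsMaximalSolution k g r₀ β (-(g β / k) * r₀) J ψ) : ψ r₀ ∈ Ioo (-α) α := by
  rw [h.1.init]
  exact ⟨by linarith [hg.alpha_pos, hg.beta_pos], hg.beta_lt_alpha⟩

end IsMaximalSolution

/-! ### The three behaviours at infinity -/

namespace IsMaximalSolution

variable {k : ℕ} {g : ℝ → ℝ} {α β r₀ : ℝ} {J : Set ℝ} {ψ : ℝ → ℝ}

lemma Ici_subset {ξ θ : ℝ} (h : IsMaximalSolution k g r₀ ξ θ J ψ) (hJ : Ioi r₀ ⊆ J) :
    Ici r₀ ⊆ J := fun r hr => by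
  rcases (mem_Ici.1 hr).eq_or_lt with rfl | h1
  · exact h.1.mem
  · exact hJ h1

/-- Below the lower threshold the solution oscillates and tends to `0`. -/
lemma oscillating (hk : 2 ≤ k) (hg : IsBistable g α β)
    (h : IsMaximalSolution k g r₀ β (-(g β / k) * r₀) J ψ) (hr₀ : r₀ < lowerRadius k g α β) :
    Ioi r₀ ⊆ J ∧ (∀ r, r₀ < r → ψ r ∈ Ioo (-α) α) ∧ IsOscillatingFrom r₀ ψ ∧ IsLocalized ψ ∧
      ∃ s : ℕ → ℝ, s 0 = r₀ ∧ StrictMono s ∧ Tendsto s atTop atTop ∧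
        (∀ n, StrictMonoOn ψ (Ioo (s n) (s (n + 1))) ∨
          StrictAntiOn ψ (Ioo (s n) (s (n + 1)))) ∧
        ∀ n, ψ (s (2 * n)) * ψ (s (2 * n + 1)) < 0 := by
  obtain ⟨a, ha0, ha, hbd⟩ := h.exists_abs_le_of_lt hk hg hr₀
  have hIoi : Ioi r₀ ⊆ J := h.Ioi_subset_of_abs_le hk hg hbd
  have hIci : Ici r₀ ⊆ J := h.Ici_subset hIoi
  have hle : ∀ r, r₀ ≤ r → |ψ r| ≤ a := fun r hr => hbd r (hIci hr) hr
  have hs : SolvesOn k g (Ici r₀) ψ (deriv ψ) := h.1.solvesOn.mono hIci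
  have hψ₀ : 0 < ψ r₀ := h.1.init ▸ hg.beta_pos
  obtain ⟨s, hs0, hmono, hlim, hprod, hsign⟩ := hs.exists_critical_seq hk hg ha hle
    (by nlinarith [h.init_deriv_neg hk hg]) hψ₀.ne'
  have hsr : ∀ n, r₀ ≤ s n := fun n => hs0 ▸ hmono.monotone n.zero_le
  have hsub : ∀ n, Ioo (s n) (s (n + 1)) ⊆ Ici r₀ := fun n r hr => (hsr n).trans hr.1.le
  refine ⟨hIoi, fun r hr => abs_lt.1 ((hle r hr.le).trans_lt ha), ⟨?_, ?_⟩,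
    (hs.mono Ioi_subset_Ici_self).tendsto_zero hk hg ha0 ha fun r hr => hle r hr.le,
    s, hs0, hmono, hlim, fun n => ?_, fun n => hprod (2 * n)⟩
  · refine ⟨s 1, hs0 ▸ hmono Nat.zero_lt_one, fun h0 => ?_⟩
    have := hprod 1
    rw [h0, zero_mul] at this
    exact this.false
  · rintro ⟨b, hb⟩
    obtain ⟨n, hn⟩ := (hlim.eventually_gt_atTop (max b r₀)).exists
    have hlt : s n < s (n + 1) := hmono n.lt_succ_self
    have hcont : ContinuousOn ψ (uIcc (s n) (s (n + 1))) := hs.continuousOn_left.mono fun r hr => by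
      rw [uIcc_of_le hlt.le] at hr
      exact (hsr n).trans hr.1
    have h0 : (0 : ℝ) ∈ uIcc (ψ (s n)) (ψ (s (n + 1))) := by
      rw [mem_uIcc]
      rcases mul_neg_iff.1 (hprod n) with h1 | h1
      · exact Or.inr ⟨h1.2.le, h1.1.le⟩
      · exact Or.inl ⟨h1.1.le, h1.2.le⟩
    obtain ⟨z, hz, hz0⟩ := intermediate_value_uIcc hcont h0
    rw [uIcc_of_le hlt.le] at hz
    have h1 := hb ⟨(le_max_right b r₀).trans_lt (hn.trans_le hz.1), hz0⟩
    linarith [le_max_left b r₀, hz.1]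
  · rcases hsign n with h1 | h1
    · exact Or.inr (strictAntiOn_of_hasDerivAt_neg ordConnected_Ioo
        (fun r hr => (hs r (hsub n hr)).2.1) fun r hr => h1 r (interior_subset hr))
    · exact Or.inl (strictMonoOn_of_hasDerivAt_pos ordConnected_Ioo
        (fun r hr => (hs r (hsub n hr)).2.1) fun r hr => h1 r (interior_subset hr))

/-- A solution which gets below `-α` decreases. -/
lemma deriv_neg_of_lt (hk : 2 ≤ k) (hg : IsBistable g α β)
    (h : IsMaximalSolution k g r₀ β (-(g β / k) * r₀) J ψ)
    (hlt : ∃ r ∈ J, r₀ < r ∧ ψ r < -α) {r : ℝ} (hr : r ∈ J) (hle : r₀ ≤ r) : deriv ψ r < 0 := by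
  obtain ⟨z, hz, hz₀, hzα⟩ := hlt
  exact h.1.solvesOn.right_neg_of_lt_neg_alpha hk hg h.1.ordConnected h.1.mem
    (h.init_mem_Ioo hg) (h.init_deriv_neg hk hg) hz hz₀.le hzα hr hle

/-- A solution which gets below `-α` tends to `-∞`. -/
lemma tendstoNegInfty (hk : 2 ≤ k) (hg : IsBistable g α β)
    (h : IsMaximalSolution k g r₀ β (-(g β / k) * r₀) J ψ)
    (hlt : ∃ r ∈ J, r₀ < r ∧ ψ r < -α) : TendstoNegInftyAtSup J ψ := by
  have hs := h.1.solvesOn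
  have hanti : AntitoneOn ψ (J ∩ Ici r₀) :=
    antitoneOn_of_hasDerivAt_nonpos (h.1.ordConnected.inter ordConnected_Ici)
      (fun r hr => (hs r hr.1).2.1) fun r hr => (h.deriv_neg_of_lt hk hg hlt hr.1 hr.2).le
  -- If bounded below, the solution would be global and would converge to a zero of `g` below `-α`,
  -- where there is none.
  have key : ∀ b : ℝ, ∃ r ∈ J, r₀ ≤ r ∧ ψ r ≤ b := by
    intro b
    by_contra! hno
    have habs : ∀ r ∈ J, r₀ ≤ r → |ψ r| ≤ max (-b) β := fun r hr hle => by
      have h1 : ψ r ≤ ψ r₀ := hanti ⟨h.1.mem, self_mem_Ici⟩ ⟨hr, hle⟩ hle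
      rw [h.1.init] at h1
      exact abs_le.2 ⟨by linarith [hno r hr hle, le_max_left (-b) β], h1.trans (le_max_right _ _)⟩
    have hIoi := h.Ioi_subset_of_abs_le hk hg habs
    have hIci := h.Ici_subset hIoi
    obtain ⟨l, hl, -, hle⟩ := exists_tendsto_of_antitoneOn
      (hanti.mono fun r hr => ⟨hIci hr, hr⟩) fun r hr => (hno r (hIci hr) hr).le
    obtain ⟨z, hz, hz₀, hzα⟩ := hlt
    have h1 := (hs.mono hIoi).map_limit_eq_zero hk hg hl
    exact (hg.pos_of_lt_neg_alpha ((hle z hz₀.le).trans_lt hzα)).ne' h1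
  have : Nonempty J := ⟨⟨r₀, h.1.mem⟩⟩
  refine tendsto_atTop_atBot.2 fun b => ?_
  obtain ⟨r, hr, hle, hb⟩ := key b
  exact ⟨⟨r, hr⟩, fun t ht => (hanti ⟨hr, hle⟩ ⟨t.2, hle.trans ht⟩ ht).trans hb⟩

/-- A nonincreasing solution which stays above `-α` tends to `-α`. -/
lemma heteroclinic (hk : 2 ≤ k) (hg : IsBistable g α β)
    (h : IsMaximalSolution k g r₀ β (-(g β / k) * r₀) J ψ)
    (hlow : ∀ r ∈ J, r₀ < r → -α ≤ ψ r) (hdec : ∀ r ∈ J, r₀ < r → deriv ψ r ≤ 0) :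
    Ioi r₀ ⊆ J ∧ (∀ r, r₀ < r → deriv ψ r < 0) ∧ Tendsto ψ atTop (𝓝 (-α)) := by
  have hβ := hg.beta_pos
  have hβα := hg.beta_lt_alpha
  have hlow' : ∀ r ∈ J, r₀ ≤ r → -α ≤ ψ r := fun r hr hle => by
    rcases hle.eq_or_lt with rfl | h1
    · exact (h.init_mem_Ioo hg).1.le
    · exact hlow r hr h1
  have hs := h.1.solvesOn
  have hanti : AntitoneOn ψ (J ∩ Ici r₀) :=
    antitoneOn_of_hasDerivAt_nonpos (h.1.ordConnected.inter ordConnected_Ici)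
      (fun r hr => (hs r hr.1).2.1) fun r hr => by
        rcases (mem_Ici.1 hr.2).eq_or_lt with h1 | h1
        · rw [← h1]; exact (h.init_deriv_neg hk hg).le
        · exact hdec r hr.1 h1
  have hleβ : ∀ r ∈ J, r₀ ≤ r → ψ r ≤ β := fun r hr hle => by
    rw [← h.1.init]
    exact hanti ⟨h.1.mem, self_mem_Ici⟩ ⟨hr, hle⟩ hle
  have hIoi : Ioi r₀ ⊆ J := h.Ioi_subset_of_abs_le hk hg (M := α) fun r hr hle =>
    abs_le.2 ⟨hlow' r hr hle, (hleβ r hr hle).trans hβα.le⟩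
  have hIci : Ici r₀ ⊆ J := h.Ici_subset hIoi
  have hneg : ∀ r, r₀ < r → deriv ψ r < 0 := fun t ht => by
    refine lt_of_le_of_ne (hdec t (hIoi ht) ht) fun h0 => ?_
    have htJ := hIoi ht
    -- A flux that is nonpositive and vanishes at `t` has a maximum there, so `g (ψ t) = 0`: the
    -- solution would be an equilibrium, contrary to `g β > 0`.
    have hmax : IsLocalMax (fun r => r ^ (k - 1) * deriv ψ r) t := by
      filter_upwards [Ioi_mem_nhds ht] with r hr
      rw [h0, mul_zero]
      exact mul_nonpos_of_nonneg_of_nonpos (pow_pos (hs r (hIoi hr)).1 _).le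
        (hdec r (hIoi hr) hr)
    have h1 := hmax.hasDerivAt_eq_zero (hs.hasDerivAt_flux hk htJ)
    have h2 : g (ψ t) = 0 := by
      rcases mul_eq_zero.1 (neg_eq_zero.1 h1) with h3 | h3
      · exact absurd h3 (pow_pos (hs t htJ).1 _).ne'
      · exact h3
    have h3 := hs.eq_of_equilibrium hg h.1.ordConnected htJ h0 h2 h.1.mem
    rw [← h3, h.1.init] at h2
    exact hg.map_beta_pos.ne' h2
  refine ⟨hIoi, hneg, ?_⟩
  obtain ⟨l, hl, hαl, hle⟩ := exists_tendsto_of_antitoneOn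
    (hanti.mono fun r hr => ⟨hIci hr, hr⟩) fun r hr => hlow' r (hIci hr) hr
  have hl0 := (hs.mono hIoi).map_limit_eq_zero hk hg hl
  have hlβ : l ≤ β := h.1.init ▸ hle r₀ le_rfl
  rcases hg.eq_of_map_eq_zero hαl (hlβ.trans_lt hβα) hl0 with rfl | rfl
  · exact hl
  -- A strictly decreasing solution with limit `0` would stay in `(0, β]`.
  · exfalso
    have hstrict : StrictAntiOn ψ (Ici r₀) := strictAntiOn_of_hasDerivAt_neg ordConnected_Ici
      (fun r hr => (hs r (hIci hr)).2.1) fun r hr => hneg r (by rwa [interior_Ici] at hr)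
    refine (hs.mono hIoi).not_forall_pos hg hβα (fun r hr => ?_) fun r hr => hleβ r (hIoi hr) hr.le
    have h1 : ψ (r + 1) < ψ r := hstrict hr.le (show r₀ ≤ r + 1 by linarith)
      (by linarith)
    linarith [hle (r + 1) (by linarith)]

end IsMaximalSolution

/-! ### Shooting in the initial radius -/

/-- The radii for which the solution gets below `-α`. -/
def crossingRadii (k : ℕ) (g : ℝ → ℝ) (α β : ℝ) : Set ℝ :=
  {r₀ | 0 < r₀ ∧ ∃ (J : Set ℝ) (ψ : ℝ → ℝ), IsMaximalSolution k g r₀ β (-(g β / k) * r₀) J ψ ∧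
    ∃ r ∈ J, r₀ < r ∧ ψ r < -α}

section Shooting

variable {k : ℕ} {g : ℝ → ℝ} {α β : ℝ}

lemma lowerRadius_pos (hk : 2 ≤ k) (hg : IsBistable g α β) : 0 < lowerRadius k g α β := by
  have hkpos : (0 : ℝ) < k := by
    have : 0 < k := by lia
    exact_mod_cast this
  have hk1 : (1 : ℝ) ≤ k := by exact_mod_cast (by lia : 1 ≤ k)
  have habs : |β| < α := by rw [abs_of_pos hg.beta_pos]; exact hg.beta_lt_alpha
  have h1 := hg.primitiveG_lt habs
  have h2 := hg.primitiveG_nonneg habs.le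
  have h3 : 1 / (k : ℝ) * primitiveG g β ≤ 1 * primitiveG g β := by
    gcongr
    rw [div_le_one hkpos]
    exact hk1
  have h4 : 0 < primitiveG g α - 1 / k * primitiveG g β := by linarith
  have h5 := hg.map_beta_pos
  rw [lowerRadius]
  have := Real.sqrt_pos.2 h4
  positivity

lemma upperRadius_nonneg (hg : IsBistable g α β) : 0 ≤ upperRadius k g α β := by
  have := hg.map_beta_pos
  rw [upperRadius]
  positivity

lemma mem_crossingRadii_of_lt (hk : 2 ≤ k) (hg : IsBistable g α β) {r₀ : ℝ}
    (hr₀ : upperRadius k g α β < r₀) : r₀ ∈ crossingRadii k g α β := by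
  have h0 : 0 < r₀ := (upperRadius_nonneg hg).trans_lt hr₀
  obtain ⟨J, ψ, h, -⟩ := exists_isMaximalSolution (k := k) hg.contDiff h0 β (-(g β / k) * r₀)
  exact ⟨h0, J, ψ, h, h.exists_lt_neg_alpha hk hg hr₀⟩

lemma lowerRadius_le_of_mem (hk : 2 ≤ k) (hg : IsBistable g α β) {r₀ : ℝ}
    (hr₀ : r₀ ∈ crossingRadii k g α β) : lowerRadius k g α β ≤ r₀ := by
  by_contra! hlt
  obtain ⟨-, J, ψ, h, r, hr, hr₀r, hα⟩ := hr₀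
  obtain ⟨a, -, ha, hbd⟩ := h.exists_abs_le_of_lt hk hg hlt
  linarith [(abs_le.1 (hbd r hr hr₀r.le)).1]

/-- At the infimum of the crossing radii the solution decreases to `-α`. -/
lemma heteroclinic_sInf (hk : 2 ≤ k) (hg : IsBistable g α β) {J : Set ℝ} {ψ : ℝ → ℝ}
    (h : IsMaximalSolution k g (sInf (crossingRadii k g α β)) β
      (-(g β / k) * sInf (crossingRadii k g α β)) J ψ) :
    Ioi (sInf (crossingRadii k g α β)) ⊆ J ∧
      (∀ r, sInf (crossingRadii k g α β) < r → deriv ψ r < 0) ∧ Tendsto ψ atTop (𝓝 (-α)) := by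
  set B := crossingRadii k g α β with hB
  have hne : B.Nonempty := ⟨_, mem_crossingRadii_of_lt hk hg (lt_add_one _)⟩
  have hbdd : BddBelow B := ⟨0, fun r hr => hr.1.le⟩
  have hΘ : ContinuousAt (fun s => -(g β / k) * s) (sInf B) := by fun_prop
  have hpos : 0 < sInf B := h.1.pos
  -- Two limit arguments: a crossing at the infimum would persist for smaller radii, and a positive
  -- derivative would persist for nearby crossing radii, whose solutions decrease.
  refine h.heteroclinic hk hg (fun r hr hlt => ?_) fun r hr hlt => ?_
  · by_contra! hα
    have hev := h.1.eventually_close hg.contDiff hΘ hr hlt (show 0 < -α - ψ r by linarith)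
    have hev' : ∀ᶠ s in 𝓝 (sInf B), s ∈ B := by
      filter_upwards [hev, Ioo_mem_nhds hpos hlt] with s hs hsI
      obtain ⟨J', χ, hχ, -⟩ := exists_isMaximalSolution (k := k) hg.contDiff hsI.1 β
        (-(g β / k) * s)
      obtain ⟨h1, h2, -⟩ := hs J' χ hχ
      exact ⟨hsI.1, J', χ, hχ, r, h1, hsI.2, by linarith [(abs_lt.1 h2).2]⟩
    obtain ⟨s, hs, hsB⟩ := ((hev'.filter_mono nhdsWithin_le_nhds).and
      (self_mem_nhdsWithin (a := sInf B) (s := Iio (sInf B)))).exists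
    exact absurd (csInf_le hbdd hs) (not_le.2 hsB)
  · by_contra! hφ
    have hev := h.1.eventually_close hg.contDiff hΘ hr hlt hφ
    -- The requirement that the perturbed radius stay below `r` is kept along, since the derivative
    -- of a crossing solution is known to be negative only from its own initial radius onwards.
    obtain ⟨δ, hδ, hball⟩ := Metric.eventually_nhds_iff.1 (hev.and (gt_mem_nhds hlt))
    obtain ⟨s, hsB, hs⟩ := exists_lt_of_csInf_lt hne (lt_add_of_pos_right (sInf B) hδ)
    obtain ⟨h1, hsr⟩ := hball (y := s) (by
      rw [Real.dist_eq, abs_of_nonneg (sub_nonneg.2 (csInf_le hbdd hsB))]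
      linarith)
    obtain ⟨-, J', χ, hχ, hcross⟩ := hsB
    obtain ⟨h2, -, h3⟩ := h1 J' χ hχ
    have := hχ.deriv_neg_of_lt hk hg hcross h2 hsr.le
    linarith [(abs_lt.1 h3).1]

end Shooting

theorem mainTheorem3 (k : ℕ) (hk : 2 ≤ k) (g : ℝ → ℝ) (α β : ℝ) (hg : IsBistable g α β) :
    -- for every `r₀ > 0` there is one and only one maximal solution
    (∀ r₀ : ℝ, 0 < r₀ → ∃ (J : Set ℝ) (ψ : ℝ → ℝ),
      IsMaximalSolution k g r₀ β (-(g β / k) * r₀) J ψ ∧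
      ∀ (J' : Set ℝ) (χ : ℝ → ℝ), IsMaximalSolution k g r₀ β (-(g β / k) * r₀) J' χ →
        J' = J ∧ EqOn χ ψ J) ∧
    ∃ rLow rStar rUp : ℝ, 0 < rLow ∧ 0 < rStar ∧ 0 < rUp ∧
      k * √2 / g β * √(primitiveG g α - 1 / k * primitiveG g β) ≤ rLow ∧
      rLow ≤ rStar ∧ rStar ≤ rUp ∧
      rUp ≤ k * √2 / g β *
        √(primitiveG g α - primitiveG g β + ((k : ℝ) - 1) / k * g β * (α + β)) ∧
      ∀ (r₀ : ℝ) (J : Set ℝ) (ψ : ℝ → ℝ), 0 < r₀ →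
        IsMaximalSolution k g r₀ β (-(g β / k) * r₀) J ψ →
        -- (i) trapped, global, oscillating, localized, with alternating monotonicity
        (r₀ < rLow →
          Ioi r₀ ⊆ J ∧ (∀ r, r₀ < r → ψ r ∈ Ioo (-α) α) ∧
          IsOscillatingFrom r₀ ψ ∧ IsLocalized ψ ∧
          ∃ s : ℕ → ℝ, s 0 = r₀ ∧ StrictMono s ∧ Tendsto s atTop atTop ∧
            (∀ n, StrictMonoOn ψ (Ioo (s n) (s (n + 1))) ∨
              StrictAntiOn ψ (Ioo (s n) (s (n + 1)))) ∧
            ∀ n, ψ (s (2 * n)) * ψ (s (2 * n + 1)) < 0) ∧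
        -- (ii) decreasing to `-α`
        (r₀ = rStar →
          Ioi r₀ ⊆ J ∧ (∀ r, r₀ < r → deriv ψ r < 0) ∧ Tendsto ψ atTop (𝓝 (-α))) ∧
        -- (iii) decreasing to `-∞`
        (rUp < r₀ →
          (∀ r ∈ J ∩ Ioi r₀, deriv ψ r < 0) ∧ TendstoNegInftyAtSup J ψ) := by

  -- The outer radii are taken equal to the explicit bounds themselves, so the two outer
  -- inequalities are equalities.
  refine ⟨fun r₀ hr₀ => exists_isMaximalSolution hg.contDiff hr₀ β _, lowerRadius k g α β,
    sInf (crossingRadii k g α β), upperRadius k g α β, ?_⟩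
  have hlow := lowerRadius_pos hk hg
  have hls : lowerRadius k g α β ≤ sInf (crossingRadii k g α β) :=
    le_csInf ⟨_, mem_crossingRadii_of_lt hk hg (lt_add_one _)⟩ fun r hr =>
      lowerRadius_le_of_mem hk hg hr
  have hsu : sInf (crossingRadii k g α β) ≤ upperRadius k g α β :=
    le_of_forall_gt_imp_ge_of_dense fun r hr =>
      csInf_le ⟨0, fun r hr => hr.1.le⟩ (mem_crossingRadii_of_lt hk hg hr)
  refine ⟨hlow, hlow.trans_le hls, hlow.trans_le (hls.trans hsu), le_rfl, hls, hsu, le_rfl,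
    fun r₀ J ψ _ h => ⟨h.oscillating hk hg, ?_, fun hr₀ => ?_⟩⟩
  · rintro rfl
    exact heteroclinic_sInf hk hg h
  · have hcross := h.exists_lt_neg_alpha hk hg hr₀
    exact ⟨fun r hr => h.deriv_neg_of_lt hk hg hcross hr.1 (le_of_lt hr.2),
      h.tendstoNegInfty hk hg hcross⟩
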